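/- Let $X_1,\dots,X_n$ be complex Banach spaces, $X=X_1\oplus\dots\oplus X_n$, and let $A=\{A_{ij}\}$, $A_{ij}\in\mathcal B(X_j,X_i)$, be a lower triangular operator matrix ($A_{ij}=0$ for $i<j$), identified with the bounded operator it induces on $X$. Let $\sigma(\cdot)$ denote the usual spectrum, and let the causal spectrum $\sigma^+(A)$ be the spectrum of $A$ in the algebra of all lower triangular operator matrices. Let $U\subseteq\mathbb C$ be an open set with $\sigma^+(A)\subseteq U$ and let $f:U\to\mathbb C$ be analytic. A contour is a finite union of oriented closed piecewise $C^1$ curves. It surrounds a set $K\subseteq U$ in $U$ if it lies in $U\setminus K$, has winding number $1$ about every point of $K$ and winding number $0$ about every point outside $U$. Let $$f(A)=\frac1{2\pi i}\int_{\Gamma_0}f(\lambda)(\lambda\mathbf 1-A)^{-1}\,d\lambda ,$$ where $\Gamma_0$ is any contour surrounding $\sigma(A)$ in $U$. For a chain of indices $i_1>i_2>\dots>i_m$, $m\ge1$, define the divided difference of $f$ with operator arguments by $$f^{[m-1]}(A;i_1,\dots,i_m)=\frac1{2\pi i}\int_{\Gamma}f(\lambda)(\lambda\mathbf 1-A_{i_1i_1})^{-1}A_{i_1i_2}(\lambda\mathbf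 1-A_{i_2i_2})^{-1}A_{i_2i_3}\cdots A_{i_{m-1}i_m}(\lambda\mathbf 1-A_{i_mi_m})^{-1}\,d\lambda ,$$ where $\Gamma$ is any contour surrounding $\sigma^+(A)$ in $U$. Then the matrix $F=f(A)$ is lower triangular, i.e. $F_{ij}=0$ for $i<j$, and for $i\ge j$ $$F_{ij}=\sum_{i=i_1>i_2>\dots>i_m=j}f^{[m-1]}(A;i_1,i_2,\dots,i_m),$$ the sum being over all $m\ge1$ and all strictly decreasing chains of indices from $i$ to $j$. Moreover, each $f^{[m-1]}(A;i_1,\dots,i_m)$ is the scalar divided difference of $f$ with operators substituted for its arguments: $$f^{[m-1]}(A;i_1,\dots,i_m)=\frac1{(2\pi i)^m}\int_{\Gamma_1}\!\!\cdots\!\int_{\Gamma_m}f^{[m-1]}(\lambda_1,\dots,\lambda_m)(\lambda_1\mathbf 1-A_{i_1i_1})^{-1}A_{i_1i_2}\cdots A_{i_{m-1}i_m}(\lambda_m\mathbf 1-A_{i_mi_m})^{-1}\,d\lambda_m\cdots d\lambda_1$$ for all contours $\Gamma_k$ surrounding $\sigma(A_{i_ki_k})$ in $U$, $k=1,\dots,m$.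 Here the scalar divided differences are given by $f^{[0]}(\mu_1)=f(\mu_1)$ and $$f^{[m]}(\mu_1,\dots,\mu_{m+1})=\frac{f^{[m-1]}(\mu_2,\dots,\mu_{m+1})-f^{[m-1]}(\mu_1,\dots,\mu_m)}{\mu_{m+1}-\mu_1},$$ the quotient being replaced, when $\mu_{m+1}=\mu_1$, by the derivative of $f^{[m-1]}(\mu_1,\dots,\mu_m)$ with respect to its first argument. -/

import Mathlib

open Set

namespace CausalCalculus

/-! ### Block operators on a finite direct sum of Banach spaces

The direct sum `X = X_1 ⊕ ⋯ ⊕ X_n` is the product space `∀ i, E i`; its norm is equivalent to the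
sum norm.  A block matrix is identified with the bounded operator on `X` that it induces. -/

section Blocks

variable {n : ℕ} {E : Fin n → Type*} [∀ i, NormedAddCommGroup (E i)] [∀ i, NormedSpace ℂ (E i)]

/-- The block `T_{ij} : X_j → X_i` of an operator `T` on `X_1 ⊕ ⋯ ⊕ X_n`. -/
noncomputable def block (T : (∀ i, E i) →L[ℂ] (∀ i, E i)) (i j : Fin n) : E j →L[ℂ] E i :=
  (ContinuousLinearMap.proj i).comp (T.comp (ContinuousLinearMap.single ℂ E j))

theorem block_apply (T : (∀ i, E i) →L[ℂ] (∀ i, E i)) (i j : Fin n) (x : E j) :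
    block T i j x = T (Pi.single j x) i := rfl

/-- An operator acts through the matrix of its blocks. -/
theorem apply_eq_sum_block (T : (∀ i, E i) →L[ℂ] (∀ i, E i)) (x : ∀ i, E i) (i : Fin n) :
    T x i = ∑ j, block T i j (x j) := by
  have h : x = ∑ j, Pi.single j (x j) := (Finset.univ_sum_single x).symm
  conv_lhs => rw [h]
  rw [map_sum, Finset.sum_apply]
  rfl

theorem block_mul (S T : (∀ i, E i) →L[ℂ] (∀ i, E i)) (i j : Fin n) :
    block (S * T) i j = ∑ k, (block S i k).comp (block T k j) := by
  ext x
  rw [_root_.sum_apply]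
  exact apply_eq_sum_block S (T (Pi.single j x)) i

variable (E) in
/-- The algebra of causal operators: those induced by lower triangular block matrices. -/
noncomputable def causalAlgebra : Subalgebra ℂ ((∀ i, E i) →L[ℂ] (∀ i, E i)) where
  carrier := {T | ∀ i j : Fin n, i < j → block T i j = 0}
  mul_mem' := by
    intro S T hS hT i j hij
    rw [block_mul]
    refine Finset.sum_eq_zero fun k _ => ?_
    rcases lt_or_ge i k with h | h
    · rw [hS i k h, ContinuousLinearMap.zero_comp]
    · rw [hT k j (lt_of_le_of_lt h hij), ContinuousLinearMap.comp_zero]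
  add_mem' := by
    intro S T hS hT i j hij
    ext x
    have h1 := DFunLike.congr_fun (hS i j hij) x
    have h2 := DFunLike.congr_fun (hT i j hij) x
    simp only [block_apply, _root_.zero_apply] at h1 h2
    simp [block_apply, h1, h2]
  algebraMap_mem' := by
    intro r i j hij
    ext x
    simp [block_apply, Algebra.algebraMap_eq_smul_one, Pi.single_eq_of_ne hij.ne]

/-- The causal spectrum `σ⁺(A)`: the spectrum of `A` in the algebra of causal operators. -/
noncomputable def causalSpectrum (A : causalAlgebra E) : Set ℂ := spectrum ℂ A

end Blocks

/-! ### Contours -/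

/-- A (positively or negatively oriented, possibly disconnected) contour in `ℂ`: finitely many
`C¹` arcs on `[0, 1]`, each one ending where the next one begins.  The cycles of the permutation
`next` are closed piecewise `C¹` curves, and every finite family of such curves is of this form. -/
structure Contour where
  /-- the number of arcs -/
  size : ℕ
  /-- the arcs -/
  arc : Fin size → ℝ → ℂ
  contDiffOn_arc : ∀ k, ContDiffOn ℝ 1 (arc k) (Icc 0 1)
  /-- the arc that follows a given arc -/
  next : Equiv.Perm (Fin size)
  arc_next : ∀ k, arc (next k) 0 = arc k 1

namespace Contour

/-- The set of points on the contour. -/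
def image (Γ : Contour) : Set ℂ := ⋃ k, Γ.arc k '' Icc 0 1

/-- The contour integral `∫_Γ F(z) dz`. -/
noncomputable def integral {G : Type*} [NormedAddCommGroup G] [NormedSpace ℂ G]
    (Γ : Contour) (F : ℂ → G) : G :=
  ∑ k, ∫ t in (0 : ℝ)..1, derivWithin (Γ.arc k) (Icc 0 1) t • F (Γ.arc k t)

/-- The winding number of the contour about `w` (for `w` off the contour). -/
noncomputable def winding (Γ : Contour) (w : ℂ) : ℂ :=
  (2 * (Real.pi : ℂ) * Complex.I)⁻¹ * Γ.integral fun z => (z - w)⁻¹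

/-- `Γ` surrounds `K` counterclockwise inside `U`: it runs in `U` off `K`, winds once around every
point of `K`, and does not wind around any point outside `U`. -/
structure Surrounds (Γ : Contour) (K U : Set ℂ) : Prop where
  image_subset : Γ.image ⊆ U \ K
  winding_eq_one : ∀ w ∈ K, Γ.winding w = 1
  winding_eq_zero : ∀ w, w ∉ U → Γ.winding w = 0

end Contour

/-- The iterated contour integral `∫_{Γ_0} ⋯ ∫_{Γ_{m-1}} F(z_0, …, z_{m-1}) dz_{m-1} ⋯ dz_0`. -/
noncomputable def iteratedIntegral {G : Type*} [NormedAddCommGroup G] [NormedSpace ℂ G] :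
    (m : ℕ) → (Fin m → Contour) → ((Fin m → ℂ) → G) → G
  | 0, _, F => F Fin.elim0
  | m + 1, Γ, F =>
      (Γ 0).integral fun w => iteratedIntegral m (Fin.tail Γ) fun v => F (Fin.cons w v)

/-- The function `f(a) = (2πi)⁻¹ ∫_Γ f(z) (z - a)⁻¹ dz` of an element `a` of a complex Banach
algebra, for a contour `Γ` surrounding the spectrum of `a` inside the domain of `f`. -/
noncomputable def holoFun {B : Type*} [NormedRing B] [NormedAlgebra ℂ B]
    (Γ : Contour) (f : ℂ → ℂ) (a : B) : B :=
  (2 * (Real.pi : ℂ) * Complex.I)⁻¹ • Γ.integral fun z => f z • resolvent a z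

/-! ### Divided differences -/

open Classical in
/-- The divided difference `f^{[m]}(μ_0, …, μ_m)`; where the denominator vanishes, the quotient
is the derivative of the previous divided difference in its first argument. -/
noncomputable def dividedDiff (f : ℂ → ℂ) : (m : ℕ) → (Fin (m + 1) → ℂ) → ℂ
  | 0, μ => f (μ 0)
  | m + 1, μ =>
      if μ (Fin.last (m + 1)) = μ 0 then
        deriv (fun w => dividedDiff f m (Function.update (Fin.init μ) 0 w)) (μ 0)
      else
        (dividedDiff f m (Fin.tail μ) - dividedDiff f m (Fin.init μ)) /
          (μ (Fin.last (m + 1)) - μ 0)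

/-- A chain `i = i_0 > i_1 > ⋯ > i_m = j` of indices, with `m` steps. -/
inductive Chain {n : ℕ} : ℕ → Fin n → Fin n → Type
  | single (i : Fin n) : Chain 0 i i
  | cons {m : ℕ} (i : Fin n) {k j : Fin n} (h : k < i) (c : Chain m k j) : Chain (m + 1) i j

namespace Chain

variable {n : ℕ}

/-- The indices `i_0, …, i_m` of a chain. -/
def idx : {m : ℕ} → {i j : Fin n} → Chain m i j → Fin (m + 1) → Fin n
  | _, _, _, single i => fun _ => i
  | _, _, _, cons i _ c => Fin.cons (α := fun _ => Fin n) i c.idx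

/-- A chain of zero steps is a single index. -/
def zeroEquiv (i j : Fin n) : Chain 0 i j ≃ PLift (i = j) where
  toFun | single _ => ⟨rfl⟩
  invFun | ⟨rfl⟩ => single i
  left_inv | single _ => rfl
  right_inv | ⟨rfl⟩ => rfl

/-- A chain of `m + 1` steps is a first step down followed by a chain of `m` steps. -/
def succEquiv (m : ℕ) (i j : Fin n) : Chain (m + 1) i j ≃ Σ k : {k : Fin n // k < i}, Chain m k j where
  toFun | cons _ h c => ⟨⟨_, h⟩, c⟩
  invFun p := cons i p.1.2 p.2
  left_inv | cons _ _ _ => rfl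
  right_inv _ := rfl

instance instFintype : (m : ℕ) → (i j : Fin n) → Fintype (Chain m i j)
  | 0, i, j => Fintype.ofEquiv _ (zeroEquiv i j).symm
  | m + 1, i, j =>
      haveI : ∀ k : {k : Fin n // k < i}, Fintype (Chain m (k : Fin n) j) :=
        fun k => instFintype m k j
      Fintype.ofEquiv _ (succEquiv m i j).symm

end Chain

section Operators

variable {n : ℕ} {E : Fin n → Type*} [∀ i, NormedAddCommGroup (E i)] [∀ i, NormedSpace ℂ (E i)]

/-- The product `(z_0 - A_{i_0 i_0})⁻¹ A_{i_0 i_1} (z_1 - A_{i_1 i_1})⁻¹ ⋯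
A_{i_{m-1} i_m} (z_m - A_{i_m i_m})⁻¹` along the chain `i_0 > ⋯ > i_m`. -/
noncomputable def chainProd (A : (∀ i, E i) →L[ℂ] (∀ i, E i)) :
    {m : ℕ} → {i j : Fin n} → Chain m i j → (Fin (m + 1) → ℂ) → (E j →L[ℂ] E i)
  | _, _, _, .single i, z => resolvent (block A i i) (z 0)
  | _, _, _, .cons (k := k) i _ c, z =>
      (resolvent (block A i i) (z 0)).comp ((block A i k).comp (chainProd A c (Fin.tail z)))

/-- The divided difference with operator arguments `f^{[m]}(A; i_0, …, i_m)` along a chain: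
`(2πi)⁻¹ ∫_Γ f(z) (z - A_{i_0 i_0})⁻¹ A_{i_0 i_1} ⋯ A_{i_{m-1} i_m} (z - A_{i_m i_m})⁻¹ dz`. -/
noncomputable def opDividedDiff (Γ : Contour) (f : ℂ → ℂ) (A : (∀ i, E i) →L[ℂ] (∀ i, E i))
    {m : ℕ} {i j : Fin n} (c : Chain m i j) : E j →L[ℂ] E i :=
  (2 * (Real.pi : ℂ) * Complex.I)⁻¹ • Γ.integral fun z => f z • chainProd A c fun _ => z

end Operators

end CausalCalculus

/-!
# The holomorphic functional calculus of lower triangular block matrices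

Off the causal spectrum, the inverse of `λ - A` is again lower triangular, and every diagonal block
`λ - A_{ii}` is invertible, because taking a diagonal block is multiplicative on causal operators.
Forward substitution (`block_resolvent_eq`) then expands the blocks of the resolvent as sums of
products along decreasing chains (`block_resolvent_eq_sum_chainProd`). The contour `Γ₀` that defines
`f(A)` may be exchanged for `Γ`, since both wind equally around every point outside
`U \ σ(A)` (`holoFun_eq_holoFun`), and the expansion is integrated term by term.

The exchange of contours rests on Cauchy's theorem for contours that do not wind around the
complement of the domain (`Contour.integral_eq_zero_of_winding`), proved for functions with values
in a Banach space by Dixon's argument. Comparison with large circles gives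
a residue theorem at infinity (`Contour.integral_eq_of_tendsto_cobounded`).

For the iterated integrals, the recursive divided differences are shown to be iterated difference
quotients, so that fixing the first node of `f^{[m+1]}` leaves a divided difference of order `m` of
`f[w, ·]` (`dividedDiff_cons`). This allows an induction along the chain in which the function
varies (`iteratedIntegral_dividedDiff_chainProd`). The step has to collapse a double integral of
`f[w, z] R(w) P(z)`, where `R` is the resolvent of a diagonal block and `P` the product along the
rest of the chain. By Fubini and the first resolvent identity the integral over `w` gives
`f(z) R(z) - R(z) f(a)`. The first term is the wanted integrand. The second contributes an integrand
that is holomorphic off the spectra of the diagonal blocks and decays faster than `z⁻¹`, so it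
integrates to zero (`integral_integral_dslope`). No contour surrounding several of the given ones
is ever needed.
-/


namespace CausalCalculus

open Filter Topology MeasureTheory

/-! ### Contour integrals -/

namespace Contour

variable {G : Type*} [NormedAddCommGroup G] [NormedSpace ℂ G]
  {H : Type*} [NormedAddCommGroup H] [NormedSpace ℂ H]

theorem arc_mem_image (Γ : Contour) (k : Fin Γ.size) {t : ℝ} (ht : t ∈ Icc (0 : ℝ) 1) :
    Γ.arc k t ∈ Γ.image :=
  mem_iUnion.2 ⟨k, mem_image_of_mem _ ht⟩

theorem continuousOn_arc (Γ : Contour) (k : Fin Γ.size) : ContinuousOn (Γ.arc k) (Icc 0 1) :=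
  (Γ.contDiffOn_arc k).continuousOn

theorem continuousOn_derivWithin_arc (Γ : Contour) (k : Fin Γ.size) :
    ContinuousOn (derivWithin (Γ.arc k) (Icc 0 1)) (Icc 0 1) :=
  (Γ.contDiffOn_arc k).continuousOn_derivWithin (uniqueDiffOn_Icc zero_lt_one) le_rfl

theorem hasDerivAt_arc (Γ : Contour) (k : Fin Γ.size) {t : ℝ} (ht : t ∈ Ioo (0 : ℝ) 1) :
    HasDerivAt (Γ.arc k) (derivWithin (Γ.arc k) (Icc 0 1) t) t :=
  ((Γ.contDiffOn_arc k).differentiableOn one_ne_zero t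
    (Ioo_subset_Icc_self ht)).hasDerivWithinAt.hasDerivAt (Icc_mem_nhds ht.1 ht.2)

theorem isCompact_image (Γ : Contour) : IsCompact Γ.image :=
  isCompact_iUnion fun k => isCompact_Icc.image_of_continuousOn (Γ.continuousOn_arc k)

theorem continuousOn_integrand (Γ : Contour) {F : ℂ → G} (hF : ContinuousOn F Γ.image)
    (k : Fin Γ.size) :
    ContinuousOn (fun t => derivWithin (Γ.arc k) (Icc 0 1) t • F (Γ.arc k t)) (Icc 0 1) :=
  (Γ.continuousOn_derivWithin_arc k).smul
    (hF.comp (Γ.continuousOn_arc k) fun _ ht => Γ.arc_mem_image k ht)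

theorem intervalIntegrable_integrand (Γ : Contour) {F : ℂ → G} (hF : ContinuousOn F Γ.image)
    (k : Fin Γ.size) :
    IntervalIntegrable (fun t => derivWithin (Γ.arc k) (Icc 0 1) t • F (Γ.arc k t)) volume 0 1 :=
  (Γ.continuousOn_integrand hF k).intervalIntegrable_of_Icc zero_le_one

theorem integral_congr (Γ : Contour) {F₁ F₂ : ℂ → G} (h : EqOn F₁ F₂ Γ.image) :
    Γ.integral F₁ = Γ.integral F₂ := by
  refine Finset.sum_congr rfl fun k _ => intervalIntegral.integral_congr fun t ht => ?_
  rw [uIcc_of_le zero_le_one] at ht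
  simp only [h (Γ.arc_mem_image k ht)]

theorem integral_zero (Γ : Contour) : Γ.integral (fun _ => (0 : G)) = 0 := by
  simp [integral]

theorem integral_sub (Γ : Contour) {F₁ F₂ : ℂ → G} (h₁ : ContinuousOn F₁ Γ.image)
    (h₂ : ContinuousOn F₂ Γ.image) :
    Γ.integral (fun z => F₁ z - F₂ z) = Γ.integral F₁ - Γ.integral F₂ := by
  simp only [integral, smul_sub]
  rw [← Finset.sum_sub_distrib]
  exact Finset.sum_congr rfl fun k _ => intervalIntegral.integral_sub
    (Γ.intervalIntegrable_integrand h₁ k) (Γ.intervalIntegrable_integrand h₂ k)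

theorem integral_finsetSum (Γ : Contour) {ι : Type*} (s : Finset ι) {F : ι → ℂ → G}
    (h : ∀ i ∈ s, ContinuousOn (F i) Γ.image) :
    Γ.integral (fun z => ∑ i ∈ s, F i z) = ∑ i ∈ s, Γ.integral (F i) := by
  simp only [integral, Finset.smul_sum]
  rw [Finset.sum_comm]
  exact Finset.sum_congr rfl fun k _ => intervalIntegral.integral_finsetSum
    fun i hi => Γ.intervalIntegrable_integrand (h i hi) k

theorem integral_const_smul (Γ : Contour) (c : ℂ) (F : ℂ → G) :
    Γ.integral (fun z => c • F z) = c • Γ.integral F := by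
  simp only [integral, Finset.smul_sum]
  refine Finset.sum_congr rfl fun k _ => ?_
  rw [← intervalIntegral.integral_smul]
  simp only [smul_comm c]

theorem integral_clm_comp [CompleteSpace G] [CompleteSpace H] (Γ : Contour) (L : G →L[ℂ] H)
    {F : ℂ → G} (hF : ContinuousOn F Γ.image) :
    Γ.integral (fun z => L (F z)) = L (Γ.integral F) := by
  simp only [integral, map_sum]
  refine Finset.sum_congr rfl fun k _ => ?_
  rw [← L.intervalIntegral_comp_comm (Γ.intervalIntegrable_integrand hF k)]
  simp only [map_smul]

theorem exists_norm_integral_le (Γ : Contour) : ∃ C : ℝ, 0 ≤ C ∧ ∀ (F : ℂ → G) (M : ℝ),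
    (∀ z ∈ Γ.image, ‖F z‖ ≤ M) → ‖Γ.integral F‖ ≤ C * M := by
  have hb : ∀ k : Fin Γ.size, ∃ C : ℝ, ∀ t ∈ Icc (0 : ℝ) 1,
      ‖derivWithin (Γ.arc k) (Icc 0 1) t‖ ≤ C := fun k =>
    isCompact_Icc.exists_bound_of_continuousOn (Γ.continuousOn_derivWithin_arc k)
  choose C hC using hb
  have hC0 : ∀ k, 0 ≤ C k := fun k =>
    (norm_nonneg _).trans (hC k 0 (left_mem_Icc.2 zero_le_one))
  refine ⟨∑ k, C k, Finset.sum_nonneg fun k _ => hC0 k, fun F M hM => ?_⟩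
  rw [Finset.sum_mul]
  refine (norm_sum_le _ _).trans (Finset.sum_le_sum fun k _ => ?_)
  have := intervalIntegral.norm_integral_le_of_norm_le_const (a := (0 : ℝ)) (b := 1)
    (f := fun t => derivWithin (Γ.arc k) (Icc 0 1) t • F (Γ.arc k t)) (C := C k * M) ?_
  · simpa using this
  · intro t ht
    rw [uIoc_of_le zero_le_one] at ht
    have ht' := Ioc_subset_Icc_self ht
    rw [norm_smul]
    exact mul_le_mul (hC k t ht') (hM _ (Γ.arc_mem_image k ht')) (norm_nonneg _) (hC0 k)

/-- A function with a primitive integrates to zero: the arcs close up. -/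
theorem integral_eq_zero_of_hasDerivAt [CompleteSpace G] (Γ : Contour) {P F : ℂ → G}
    (hP : ∀ z ∈ Γ.image, HasDerivAt P (F z) z) (hF : ContinuousOn F Γ.image) :
    Γ.integral F = 0 := by
  have h : ∀ k, ∫ t in (0 : ℝ)..1, derivWithin (Γ.arc k) (Icc 0 1) t • F (Γ.arc k t) =
      P (Γ.arc k 1) - P (Γ.arc k 0) := fun k => by
    refine intervalIntegral.integral_eq_sub_of_hasDerivAt_of_le (f := fun t => P (Γ.arc k t))
      zero_le_one ?_ (fun t ht => ?_) (Γ.intervalIntegrable_integrand hF k)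
    · have hPc : ContinuousOn P Γ.image := fun z hz => (hP z hz).continuousAt.continuousWithinAt
      exact hPc.comp (Γ.continuousOn_arc k) fun t ht => Γ.arc_mem_image k ht
    · exact (hP _ (Γ.arc_mem_image k (Ioo_subset_Icc_self ht))).scomp t (Γ.hasDerivAt_arc k ht)
  rw [integral, Finset.sum_congr rfl fun k _ => h k, Finset.sum_sub_distrib, sub_eq_zero,
    ← Equiv.sum_comp Γ.next fun k => P (Γ.arc k 0)]
  simp only [Γ.arc_next]

/-- Fubini's theorem for contour integrals of continuous functions. -/
theorem integral_swap [CompleteSpace G] (Γ₁ Γ₂ : Contour) {Φ : ℂ → ℂ → G}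
    (hΦ : ContinuousOn (Function.uncurry Φ) (Γ₁.image ×ˢ Γ₂.image)) :
    Γ₁.integral (fun w => Γ₂.integral (Φ w)) =
      Γ₂.integral (fun z => Γ₁.integral fun w => Φ w z) := by
  have hsec₁ : ∀ w ∈ Γ₁.image, ContinuousOn (Φ w) Γ₂.image := fun w hw =>
    hΦ.comp (f := fun z => (w, z)) (by fun_prop) fun z hz => ⟨hw, hz⟩
  have hsec₂ : ∀ z ∈ Γ₂.image, ContinuousOn (fun w => Φ w z) Γ₁.image := fun z hz =>
    hΦ.comp (f := fun w => (w, z)) (by fun_prop) fun w hw => ⟨hw, hz⟩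
  have key : ∀ k l, ContinuousOn (Function.uncurry fun s t : ℝ =>
      derivWithin (Γ₁.arc k) (Icc 0 1) s • derivWithin (Γ₂.arc l) (Icc 0 1) t •
        Φ (Γ₁.arc k s) (Γ₂.arc l t)) (Icc 0 1 ×ˢ Icc 0 1) := fun k l => by
    have hfst : MapsTo Prod.fst (Icc (0 : ℝ) 1 ×ˢ Icc (0 : ℝ) 1) (Icc 0 1) := fun p hp => hp.1
    have hsnd : MapsTo Prod.snd (Icc (0 : ℝ) 1 ×ˢ Icc (0 : ℝ) 1) (Icc 0 1) := fun p hp => hp.2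
    refine ((Γ₁.continuousOn_derivWithin_arc k).comp continuousOn_fst hfst).smul
      (((Γ₂.continuousOn_derivWithin_arc l).comp continuousOn_snd hsnd).smul ?_)
    exact hΦ.comp (((Γ₁.continuousOn_arc k).comp continuousOn_fst hfst).prodMk
      ((Γ₂.continuousOn_arc l).comp continuousOn_snd hsnd))
      fun p hp => ⟨Γ₁.arc_mem_image k hp.1, Γ₂.arc_mem_image l hp.2⟩
  have hint : ∀ k l, Integrable (Function.uncurry fun s t : ℝ =>
      derivWithin (Γ₁.arc k) (Icc 0 1) s • derivWithin (Γ₂.arc l) (Icc 0 1) t •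
        Φ (Γ₁.arc k s) (Γ₂.arc l t))
      ((volume.restrict (Ioc (0 : ℝ) 1)).prod (volume.restrict (Ioc (0 : ℝ) 1))) := fun k l => by
    rw [Measure.prod_restrict]
    exact ((key k l).integrableOn_compact (isCompact_Icc.prod isCompact_Icc)).mono_set
      (prod_mono Ioc_subset_Icc_self Ioc_subset_Icc_self)
  have hleft : Γ₁.integral (fun w => Γ₂.integral (Φ w)) = ∑ k, ∑ l,
      ∫ s in (0 : ℝ)..1, ∫ t in (0 : ℝ)..1, derivWithin (Γ₁.arc k) (Icc 0 1) s •
        derivWithin (Γ₂.arc l) (Icc 0 1) t • Φ (Γ₁.arc k s) (Γ₂.arc l t) := by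
    refine Finset.sum_congr rfl fun k _ => ?_
    rw [← intervalIntegral.integral_finsetSum]
    · simp only [integral, Finset.smul_sum, intervalIntegral.integral_smul]
    · intro l _
      simp only [intervalIntegrable_iff_integrableOn_Ioc_of_le zero_le_one,
        intervalIntegral.integral_of_le zero_le_one]
      exact (hint k l).integral_prod_left
  have hright : Γ₂.integral (fun z => Γ₁.integral fun w => Φ w z) = ∑ l, ∑ k,
      ∫ t in (0 : ℝ)..1, ∫ s in (0 : ℝ)..1, derivWithin (Γ₁.arc k) (Icc 0 1) s •
        derivWithin (Γ₂.arc l) (Icc 0 1) t • Φ (Γ₁.arc k s) (Γ₂.arc l t) := by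
    refine Finset.sum_congr rfl fun l _ => ?_
    rw [← intervalIntegral.integral_finsetSum]
    · refine intervalIntegral.integral_congr fun t _ => ?_
      simp only [integral, Finset.smul_sum]
      refine Finset.sum_congr rfl fun k _ => ?_
      rw [← intervalIntegral.integral_smul]
      simp only [smul_comm (derivWithin (Γ₂.arc l) (Icc 0 1) t)]
    · intro k _
      simp only [intervalIntegrable_iff_integrableOn_Ioc_of_le zero_le_one,
        intervalIntegral.integral_of_le zero_le_one]
      exact (hint k l).integral_prod_right
  rw [hleft, hright, Finset.sum_comm]
  refine Finset.sum_congr rfl fun l _ => Finset.sum_congr rfl fun k _ => ?_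
  simp only [intervalIntegral.integral_of_le zero_le_one]
  exact integral_integral_swap (hint k l)

/-- A contour integral of a function that depends holomorphically on a parameter may be
differentiated under the integral sign. -/
theorem hasDerivAt_integral_param [CompleteSpace G] (Γ : Contour) {V : Set ℂ} (hV : IsOpen V)
    {Φ : ℂ → ℂ → G} (hΦ : ContinuousOn (Function.uncurry Φ) (V ×ˢ Γ.image))
    (hd : ∀ w ∈ Γ.image, DifferentiableOn ℂ (fun z => Φ z w) V) {z₀ : ℂ} (hz₀ : z₀ ∈ V) :
    HasDerivAt (fun z => Γ.integral (Φ z)) (Γ.integral fun w => deriv (fun z => Φ z w) z₀) z₀ := by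
  obtain ⟨r, hr, hball⟩ : ∃ r > 0, Metric.closedBall z₀ (r + r) ⊆ V := by
    obtain ⟨ε, hε, h⟩ := Metric.nhds_basis_closedBall.mem_iff.1 (hV.mem_nhds hz₀)
    exact ⟨ε / 2, half_pos hε, by rwa [add_halves]⟩
  obtain ⟨M, hM⟩ := ((isCompact_closedBall z₀ (r + r)).prod
    Γ.isCompact_image).exists_bound_of_continuousOn (hΦ.mono (prod_mono_left hball))
  have hsec : ∀ z ∈ V, ContinuousOn (Φ z) Γ.image := fun z hz =>
    hΦ.comp (f := fun w => (z, w)) (by fun_prop) fun w hw => ⟨hz, hw⟩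
  have hderiv : ∀ w ∈ Γ.image, ∀ z ∈ V, HasDerivAt (fun z => Φ z w) (deriv (fun z => Φ z w) z) z :=
    fun w hw z hz => ((hd w hw).differentiableAt (hV.mem_nhds hz)).hasDerivAt
  -- Cauchy's estimate dominates the derivatives near `z₀`.
  have hbound : ∀ w ∈ Γ.image, ∀ z ∈ Metric.ball z₀ r, ‖deriv (fun z => Φ z w) z‖ ≤ M / r := by
    intro w hw z hz
    have hsub : Metric.closedBall z r ⊆ Metric.closedBall z₀ (r + r) :=
      Metric.closedBall_subset_closedBall' (by have := Metric.mem_ball.1 hz; linarith)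
    refine Complex.norm_deriv_le_of_forall_mem_sphere_norm_le hr ?_ fun y hy =>
      hM (y, w) ⟨hsub (Metric.sphere_subset_closedBall hy), hw⟩
    refine DifferentiableOn.diffContOnCl ((hd w hw).mono ?_)
    rw [closure_ball _ hr.ne']
    exact hsub.trans hball
  refine HasDerivAt.fun_sum fun k _ => ?_
  have hI : ∀ t ∈ Ioc (0 : ℝ) 1, Γ.arc k t ∈ Γ.image := fun t ht =>
    Γ.arc_mem_image k (Ioc_subset_Icc_self ht)
  have hmeas : ∀ z ∈ V, AEStronglyMeasurable (fun t => Φ z (Γ.arc k t))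
      (volume.restrict (Ioc 0 1)) := fun z hz =>
    (((hsec z hz).comp (Γ.continuousOn_arc k) fun _ ht => Γ.arc_mem_image k ht).mono
      Ioc_subset_Icc_self).aestronglyMeasurable measurableSet_Ioc
  have hmeas' : AEStronglyMeasurable (derivWithin (Γ.arc k) (Icc 0 1))
      (volume.restrict (Ioc 0 1)) :=
    ((Γ.continuousOn_derivWithin_arc k).mono
      Ioc_subset_Icc_self).aestronglyMeasurable measurableSet_Ioc
  have hVev : ∀ᶠ z in 𝓝 z₀, z ∈ V := hV.mem_nhds hz₀
  -- The derivative is measurable along the arc as a limit of difference quotients.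
  have hmeasd : AEStronglyMeasurable (fun t => deriv (fun z => Φ z (Γ.arc k t)) z₀)
      (volume.restrict (Ioc 0 1)) := by
    obtain ⟨u, hu⟩ := exists_seq_tendsto (𝓝[≠] z₀)
    obtain ⟨N, hN⟩ : ∃ N, ∀ n, u (n + N) ∈ V := by
      obtain ⟨N, hN⟩ := eventually_atTop.1 ((hu.mono_right nhdsWithin_le_nhds).eventually hVev)
      exact ⟨N, fun n => hN _ (Nat.le_add_left _ _)⟩
    refine aestronglyMeasurable_of_tendsto_ae atTop
      (f := fun n t => (u (n + N) - z₀)⁻¹ • (Φ (u (n + N)) (Γ.arc k t) - Φ z₀ (Γ.arc k t)))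
      (fun n => ((hmeas _ (hN n)).sub (hmeas _ hz₀)).const_smul _) ?_
    refine (ae_restrict_iff' measurableSet_Ioc).2 (Eventually.of_forall fun t ht => ?_)
    exact (hasDerivAt_iff_tendsto_slope.1 (hderiv _ (hI t ht) z₀ hz₀)).comp
      ((tendsto_add_atTop_iff_nat N).2 hu)
  obtain ⟨C, hC⟩ := isCompact_Icc.exists_bound_of_continuousOn (Γ.continuousOn_derivWithin_arc k)
  refine (intervalIntegral.hasDerivAt_integral_of_dominated_loc_of_deriv_le
    (F := fun z t => derivWithin (Γ.arc k) (Icc 0 1) t • Φ z (Γ.arc k t))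
    (F' := fun z t => derivWithin (Γ.arc k) (Icc 0 1) t • deriv (fun z => Φ z (Γ.arc k t)) z)
    (bound := fun _ => C * (M / r)) (Metric.ball_mem_nhds z₀ hr) ?_
    (Γ.intervalIntegrable_integrand (hsec z₀ hz₀) k) ?_ ?_ intervalIntegrable_const ?_).2
  · rw [uIoc_of_le zero_le_one]
    exact hVev.mono fun z hz => hmeas'.smul (hmeas z hz)
  · rw [uIoc_of_le zero_le_one]
    exact hmeas'.smul hmeasd
  · refine Eventually.of_forall fun t ht z hz => ?_
    rw [uIoc_of_le zero_le_one] at ht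
    have hCt := hC t (Ioc_subset_Icc_self ht)
    rw [norm_smul]
    exact mul_le_mul hCt (hbound _ (hI t ht) z hz) (norm_nonneg _) ((norm_nonneg _).trans hCt)
  · refine Eventually.of_forall fun t ht z hz => ?_
    rw [uIoc_of_le zero_le_one] at ht
    exact (hderiv _ (hI t ht) z (hball (Metric.ball_subset_closedBall
      (Metric.ball_subset_ball (by linarith) hz)))).const_smul _

/-! ### Differences of contours and circles -/

/-- The formal difference of two contours: the arcs of the first one together with the reversed
arcs of the second one. -/
noncomputable def sub (Γ₁ Γ₂ : Contour) : Contour where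
  size := Γ₁.size + Γ₂.size
  arc := Fin.append Γ₁.arc fun k t => Γ₂.arc k (1 - t)
  contDiffOn_arc k := by
    refine Fin.addCases (fun k => ?_) (fun k => ?_) k
    · rw [Fin.append_left]
      exact Γ₁.contDiffOn_arc k
    · rw [Fin.append_right]
      exact (Γ₂.contDiffOn_arc k).comp (by fun_prop) fun t ht =>
        ⟨by linarith [ht.2], by linarith [ht.1]⟩
  next := (finSumFinEquiv.symm.trans (Equiv.sumCongr Γ₁.next Γ₂.next.symm)).trans finSumFinEquiv
  arc_next k := by
    refine Fin.addCases (fun k => ?_) (fun k => ?_) k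
    · simp [Γ₁.arc_next]
    · simp [← Γ₂.arc_next (Γ₂.next.symm k)]

theorem image_sub (Γ₁ Γ₂ : Contour) : (Γ₁.sub Γ₂).image ⊆ Γ₁.image ∪ Γ₂.image := by
  refine iUnion_subset fun k => ?_
  rintro _ ⟨t, ht, rfl⟩
  refine Fin.addCases (fun k => ?_) (fun k => ?_) k
  · simp only [sub, Fin.append_left]
    exact Or.inl (Γ₁.arc_mem_image k ht)
  · simp only [sub, Fin.append_right]
    exact Or.inr (Γ₂.arc_mem_image k ⟨by linarith [ht.2], by linarith [ht.1]⟩)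

theorem integral_contour_sub (Γ₁ Γ₂ : Contour) (F : ℂ → G) :
    (Γ₁.sub Γ₂).integral F = Γ₁.integral F - Γ₂.integral F := by
  have hrev : ∀ k : Fin Γ₂.size, ∀ t ∈ Ioo (0 : ℝ) 1,
      derivWithin (fun s => Γ₂.arc k (1 - s)) (Icc 0 1) t =
        -derivWithin (Γ₂.arc k) (Icc 0 1) (1 - t) := fun k t ht => by
    have h := (Γ₂.hasDerivAt_arc k (t := 1 - t) ⟨by linarith [ht.2], by linarith [ht.1]⟩).scomp t
      ((hasDerivAt_id t).const_sub 1)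
    rw [neg_one_smul] at h
    exact h.hasDerivWithinAt.derivWithin (uniqueDiffOn_Icc zero_lt_one t (Ioo_subset_Icc_self ht))
  have h := Fin.sum_univ_add (M := G) (a := Γ₁.size) (b := Γ₂.size) fun k =>
    ∫ t in (0 : ℝ)..1, derivWithin ((Γ₁.sub Γ₂).arc k) (Icc 0 1) t • F ((Γ₁.sub Γ₂).arc k t)
  refine h.trans ?_
  rw [sub_eq_add_neg, integral, integral, ← Finset.sum_neg_distrib]
  simp only [sub, Fin.append_left, Fin.append_right]
  congr 1
  refine Finset.sum_congr rfl fun k _ => ?_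
  have h2 := intervalIntegral.integral_comp_sub_left (a := 0) (b := 1)
    (fun t => derivWithin (Γ₂.arc k) (Icc 0 1) t • F (Γ₂.arc k t)) 1
  rw [sub_self, sub_zero] at h2
  rw [← h2, ← intervalIntegral.integral_neg]
  refine intervalIntegral.integral_congr_Ioo_of_le zero_le_one fun t ht => ?_
  simp only [hrev k t ht, neg_smul]

/-- The circle of radius `r` about the origin, run through once counterclockwise. -/
noncomputable def circle (r : ℝ) : Contour where
  size := 1
  arc _ t := circleMap 0 r (2 * Real.pi * t)
  contDiffOn_arc _ := by
    refine ContDiff.contDiffOn ?_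
    exact (contDiff_circleMap 0 r).comp (by fun_prop)
  next := Equiv.refl _
  arc_next _ := by simp [circleMap]

theorem image_circle_subset {r : ℝ} (hr : 0 ≤ r) : (circle r).image ⊆ Metric.sphere 0 r := by
  refine iUnion_subset fun k => ?_
  rintro _ ⟨t, -, rfl⟩
  exact circleMap_mem_sphere 0 hr _

theorem integral_circle (r : ℝ) (F : ℂ → G) : (circle r).integral F = ∮ z in C(0, r), F z := by
  have hd : ∀ t ∈ Ioo (0 : ℝ) 1, derivWithin (fun t => circleMap 0 r (2 * Real.pi * t)) (Icc 0 1) t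
      = (2 * Real.pi : ℝ) • deriv (circleMap 0 r) (2 * Real.pi * t) := fun t ht => by
    have h := (differentiable_circleMap 0 r (2 * Real.pi * t)).hasDerivAt.scomp t
      ((hasDerivAt_id t).const_mul (2 * Real.pi))
    rw [mul_one] at h
    exact h.hasDerivWithinAt.derivWithin (uniqueDiffOn_Icc zero_lt_one t (Ioo_subset_Icc_self ht))
  have h := intervalIntegral.smul_integral_comp_mul_left (a := 0) (b := 1)
    (fun t => deriv (circleMap 0 r) t • F (circleMap 0 r t)) (2 * Real.pi)
  rw [mul_zero, mul_one] at h
  rw [circleIntegral, ← h, ← intervalIntegral.integral_smul]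
  refine (Fin.sum_univ_one _).trans ?_
  refine intervalIntegral.integral_congr_Ioo_of_le zero_le_one fun t ht => ?_
  simp only [circle, hd t ht, smul_assoc]

end Contour

/-! ### Difference quotients of holomorphic functions -/

section Dslope

variable {G : Type*} [NormedAddCommGroup G] [NormedSpace ℂ G]

theorem dslope_comm (F : ℂ → G) (z w : ℂ) : dslope F z w = dslope F w z := by
  rcases eq_or_ne w z with rfl | h
  · rfl
  · rw [dslope_of_ne F h, dslope_of_ne F h.symm, slope_comm]

/-- The difference quotient of a holomorphic function is jointly continuous: on the diagonal this
is strict differentiability. -/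
theorem continuousOn_uncurry_dslope [CompleteSpace G] {V : Set ℂ} (hV : IsOpen V) {F : ℂ → G}
    (hF : DifferentiableOn ℂ F V) :
    ContinuousOn (Function.uncurry (dslope F)) (V ×ˢ V) := by
  rintro ⟨a, b⟩ ⟨ha, hb⟩
  refine ContinuousAt.continuousWithinAt ?_
  have hcont : ∀ z ∈ V, ContinuousAt F z := fun z hz =>
    (hF.differentiableAt (hV.mem_nhds hz)).continuousAt
  rcases eq_or_ne b a with rfl | hab
  · have hstrict := (hF.analyticAt (hV.mem_nhds hb)).hasStrictDerivAt
    have hderiv : ContinuousAt (deriv F) b :=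
      ((hF.analyticAt (hV.mem_nhds hb)).deriv).continuousAt
    have hfst : Tendsto (fun p : ℂ × ℂ => deriv F p.1) (𝓝 (b, b)) (𝓝 (deriv F b)) :=
      hderiv.tendsto.comp (continuous_fst.tendsto (b, b))
    change Tendsto (Function.uncurry (dslope F)) (𝓝 (b, b)) (𝓝 (dslope F b b))
    rw [dslope_same, Metric.tendsto_nhds]
    intro ε hε
    have h1 := hstrict.hasStrictFDerivAt.isLittleO.def (half_pos hε)
    filter_upwards [h1, Metric.tendsto_nhds.1 hfst ε hε] with p hp1 hp2
    obtain ⟨z, w⟩ := p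
    rcases eq_or_ne w z with rfl | hwz
    · simpa [Function.uncurry] using hp2
    · simp only [Function.uncurry]
      have hne : 0 < ‖z - w‖ := norm_pos_iff.2 (sub_ne_zero.2 hwz.symm)
      have heq : dslope F z w - deriv F b =
          (z - w)⁻¹ • (F z - F w - (z - w) • deriv F b) := by
        rw [dslope_comm, dslope_of_ne F hwz.symm, slope_def_module, smul_sub _ (F z - F w),
          inv_smul_smul₀ (sub_ne_zero.2 hwz.symm)]
      rw [dist_eq_norm, heq, norm_smul, norm_inv]
      calc ‖z - w‖⁻¹ * ‖F z - F w - (z - w) • deriv F b‖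
          ≤ ‖z - w‖⁻¹ * (ε / 2 * ‖z - w‖) := by gcongr; simpa using hp1
        _ = ε / 2 := by field_simp
        _ < ε := half_lt_self hε
  · have hne : ∀ᶠ p : ℂ × ℂ in 𝓝 (a, b), p.2 ≠ p.1 :=
      (isOpen_ne_fun continuous_snd continuous_fst).mem_nhds hab
    have hc : ContinuousAt (fun p : ℂ × ℂ => (p.2 - p.1)⁻¹ • (F p.2 - F p.1)) (a, b) := by
      refine ContinuousAt.smul (ContinuousAt.inv₀ (by fun_prop) (sub_ne_zero.2 hab)) ?_
      exact ((hcont b hb).comp (f := Prod.snd) continuousAt_snd).sub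
        ((hcont a ha).comp (f := Prod.fst) continuousAt_fst)
    refine hc.congr ?_
    filter_upwards [hne] with p hp
    rw [Function.uncurry, dslope_of_ne F hp, slope_def_module]

end Dslope

/-! ### Cauchy's theorem for contours that do not wind around the complement -/

namespace Contour

variable {G : Type*} [NormedAddCommGroup G] [NormedSpace ℂ G]

theorem continuousOn_cauchyKernel (Γ : Contour) {F : ℂ → G} (hF : ContinuousOn F Γ.image) :
    ContinuousOn (Function.uncurry fun z w : ℂ => (w - z)⁻¹ • F w) (Γ.imageᶜ ×ˢ Γ.image) := by
  refine ContinuousOn.smul (ContinuousOn.inv₀ (by fun_prop) ?_)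
    (hF.comp continuousOn_snd fun p hp => hp.2)
  rintro ⟨z, w⟩ ⟨hz, hw⟩ h
  exact hz (by rwa [← sub_eq_zero.1 h])

theorem hasDerivAt_cauchyKernel {z w : ℂ} (h : w ≠ z) (x : G) :
    HasDerivAt (fun z => (w - z)⁻¹ • x) (((w - z) ^ 2)⁻¹ • x) z := by
  have h1 := (((hasDerivAt_id z).const_sub w).inv (sub_ne_zero.2 h)).smul_const x
  simpa [neg_neg, one_div] using h1

theorem hasDerivAt_cauchyTransform [CompleteSpace G] (Γ : Contour) {F : ℂ → G}
    (hF : ContinuousOn F Γ.image) {z : ℂ} (hz : z ∉ Γ.image) :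
    HasDerivAt (fun z => Γ.integral fun w => (w - z)⁻¹ • F w)
      (Γ.integral fun w => ((w - z) ^ 2)⁻¹ • F w) z := by
  have hne : ∀ w ∈ Γ.image, ∀ y ∉ Γ.image, w ≠ y := fun w hw y hy h => hy (h ▸ hw)
  have h := Γ.hasDerivAt_integral_param Γ.isCompact_image.isClosed.isOpen_compl
    (Γ.continuousOn_cauchyKernel hF) (fun w hw y hy =>
      (hasDerivAt_cauchyKernel (hne w hw y hy) (F w)).differentiableAt.differentiableWithinAt) hz
  convert h using 1
  exact Γ.integral_congr fun w hw => (hasDerivAt_cauchyKernel (hne w hw z hz) (F w)).deriv.symm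

theorem tendsto_cauchyTransform_cocompact (Γ : Contour) {F : ℂ → G}
    (hF : ContinuousOn F Γ.image) :
    Tendsto (fun z => Γ.integral fun w => (w - z)⁻¹ • F w) (cocompact ℂ) (𝓝 0) := by
  obtain ⟨C, hC0, hC⟩ := Γ.exists_norm_integral_le (G := G)
  obtain ⟨M, hM⟩ := Γ.isCompact_image.exists_bound_of_continuousOn hF
  obtain ⟨R, hR⟩ := Γ.isCompact_image.isBounded.exists_norm_le
  have hlim : Tendsto (fun z : ℂ => C * ((‖z‖ - R)⁻¹ * M)) (cocompact ℂ) (𝓝 0) := by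
    have h1 : Tendsto (fun z : ℂ => ‖z‖ - R) (cocompact ℂ) atTop :=
      tendsto_atTop_add_const_right _ (-R) (tendsto_norm_cocompact_atTop (E := ℂ))
    simpa using (h1.inv_tendsto_atTop.mul_const M).const_mul C
  refine squeeze_zero_norm' ?_ hlim
  filter_upwards [(tendsto_norm_cocompact_atTop (E := ℂ)).eventually_gt_atTop R] with z hz
  refine hC _ _ fun w hw => ?_
  rw [norm_smul, norm_inv]
  have h1 : ‖z‖ - R ≤ ‖w - z‖ := by
    rw [norm_sub_rev]
    linarith [norm_sub_norm_le z w, hR w hw]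
  have h2 : 0 < ‖z‖ - R := sub_pos.2 hz
  exact mul_le_mul (inv_anti₀ h2 h1) (hM w hw) (norm_nonneg _) (inv_nonneg.2 h2.le)

theorem winding_eq_smul (Γ : Contour) (z : ℂ) :
    Γ.winding z = (2 * (Real.pi : ℂ) * Complex.I)⁻¹ *
      Γ.integral (fun w => (w - z)⁻¹ • (1 : ℂ)) := by
  simp only [winding, smul_eq_mul, mul_one]

/-- The winding number is locally constant: its derivative is the integral of `(w - z)⁻²`, which
has a primitive. -/
theorem hasDerivAt_winding (Γ : Contour) {z : ℂ} (hz : z ∉ Γ.image) :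
    HasDerivAt Γ.winding 0 z := by
  have h := (Γ.hasDerivAt_cauchyTransform (F := fun _ => (1 : ℂ)) continuousOn_const hz).const_mul
    (2 * (Real.pi : ℂ) * Complex.I)⁻¹
  have hne : ∀ w ∈ Γ.image, w ≠ z := fun w hw h => hz (h ▸ hw)
  have h0 : Γ.integral (fun w => ((w - z) ^ 2)⁻¹ • (1 : ℂ)) = 0 := by
    refine Γ.integral_eq_zero_of_hasDerivAt (P := fun w => -(w - z)⁻¹) (fun w hw => ?_) ?_
    · have h1 := (((hasDerivAt_id w).sub_const z).inv (sub_ne_zero.2 (hne w hw))).fun_neg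
      simpa [neg_div, one_div] using h1
    · refine ContinuousOn.smul (ContinuousOn.inv₀ (f := fun w : ℂ => (w - z) ^ 2) (by fun_prop)
        fun w hw => ?_) continuousOn_const
      exact pow_ne_zero _ (sub_ne_zero.2 (hne w hw))
  rw [h0, mul_zero] at h
  exact h.congr_of_eventuallyEq (Eventually.of_forall Γ.winding_eq_smul)

theorem winding_eq_of_isPreconnected (Γ : Contour) {S : Set ℂ} (hS : IsOpen S)
    (hS' : IsPreconnected S) (hdisj : ∀ z ∈ S, z ∉ Γ.image) {z w : ℂ} (hz : z ∈ S) (hw : w ∈ S) :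
    Γ.winding z = Γ.winding w :=
  hS.is_const_of_deriv_eq_zero hS' (fun y hy =>
    (Γ.hasDerivAt_winding (hdisj y hy)).differentiableAt.differentiableWithinAt)
    (fun y hy => (Γ.hasDerivAt_winding (hdisj y hy)).deriv) hz hw

theorem eventually_winding_eq (Γ : Contour) {z : ℂ} (hz : z ∉ Γ.image) :
    ∀ᶠ y in 𝓝 z, y ∉ Γ.image ∧ Γ.winding y = Γ.winding z := by
  obtain ⟨r, hr, hball⟩ := Metric.isOpen_iff.1 Γ.isCompact_image.isClosed.isOpen_compl z hz
  filter_upwards [Metric.ball_mem_nhds z hr] with y hy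
  exact ⟨hball hy, Γ.winding_eq_of_isPreconnected Metric.isOpen_ball
    (convex_ball z r).isPreconnected (fun _ h => hball h) hy (Metric.mem_ball_self hr)⟩

/-- The winding number vanishes at infinity. -/
theorem eventually_winding_eq_zero (Γ : Contour) :
    ∀ᶠ z in cocompact ℂ, z ∉ Γ.image ∧ Γ.winding z = 0 := by
  obtain ⟨R, hR0, hR⟩ := Γ.isCompact_image.isBounded.exists_pos_norm_le
  have hlim : Tendsto Γ.winding (cocompact ℂ) (𝓝 0) := by
    have h := (Γ.tendsto_cauchyTransform_cocompact (F := fun _ => (1 : ℂ))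
      continuousOn_const).const_mul (2 * (Real.pi : ℂ) * Complex.I)⁻¹
    rw [mul_zero] at h
    exact h.congr fun z => (Γ.winding_eq_smul z).symm
  filter_upwards [(tendsto_norm_cocompact_atTop (E := ℂ)).eventually_gt_atTop R] with z hz
  have hz0 : 0 < ‖z‖ := hR0.trans hz
  -- On the half-plane beyond the disc in the direction of `z` the winding number is constant.
  let S : Set ℂ := {y | R * ‖z‖ < inner ℝ z y}
  have hSo : IsOpen S := isOpen_lt continuous_const (by fun_prop)
  have hSc : Convex ℝ S := convex_halfSpace_gt (innerₛₗ ℝ z).isLinear _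
  have hdisj : ∀ y ∈ S, y ∉ Γ.image := fun y hy hmem => by
    have h1 := real_inner_le_norm z y
    have h2 : ‖z‖ * ‖y‖ ≤ ‖z‖ * R := mul_le_mul_of_nonneg_left (hR y hmem) hz0.le
    have h3 : R * ‖z‖ < inner ℝ z y := hy
    linarith
  have hmem : ∀ n : ℕ, ((n : ℝ) + 1) • z ∈ S := fun n => by
    change R * ‖z‖ < inner ℝ z (((n : ℝ) + 1) • z)
    rw [inner_smul_right, real_inner_self_eq_norm_sq]
    have h1 : R * ‖z‖ < ‖z‖ ^ 2 := by nlinarith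
    have h2 : (0 : ℝ) ≤ n * ‖z‖ ^ 2 := by positivity
    nlinarith
  have hz : z ∈ S := by simpa using hmem 0
  refine ⟨hdisj z hz, ?_⟩
  have htend : Tendsto (fun n : ℕ => ((n : ℝ) + 1) • z) atTop (cocompact ℂ) := by
    rw [← Metric.cobounded_eq_cocompact, ← tendsto_norm_atTop_iff_cobounded]
    have h1 : Tendsto (fun n : ℕ => ((n : ℝ) + 1) * ‖z‖) atTop atTop :=
      (tendsto_atTop_add_const_right _ 1 tendsto_natCast_atTop_atTop).atTop_mul_const hz0
    refine h1.congr fun n => ?_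
    rw [norm_smul, Real.norm_of_nonneg (by positivity)]
  refine tendsto_nhds_unique (tendsto_const_nhds (x := Γ.winding z) (f := atTop))
    ((hlim.comp htend).congr fun n => ?_)
  exact Γ.winding_eq_of_isPreconnected hSo hSc.isPreconnected hdisj (hmem n) hz

/-- Dixon's argument: the integral of the difference quotient of `F` at `z ∈ V` and the Cauchy
transform of `F` off `V` fit together to an entire function of `z` that tends to zero at infinity,
which vanishes by Liouville's theorem. -/
theorem integral_dslope_eq_zero [CompleteSpace G] (Γ : Contour) {V : Set ℂ} (hV : IsOpen V)
    {F : ℂ → G} (hF : DifferentiableOn ℂ F V) (hΓ : Γ.image ⊆ V)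
    (hw : ∀ z, z ∉ V → Γ.winding z = 0) {z : ℂ} (hz : z ∈ V) :
    Γ.integral (dslope F z) = 0 := by
  classical
  have hFc : ContinuousOn F Γ.image := hF.continuousOn.mono hΓ
  let h : ℂ → G := fun z =>
    if z ∈ V then Γ.integral (dslope F z) else Γ.integral fun w => (w - z)⁻¹ • F w
  have h2pi : (2 * (Real.pi : ℂ) * Complex.I)⁻¹ ≠ 0 := inv_ne_zero Complex.two_pi_I_ne_zero
  -- Off the contour, the two formulas agree where the winding number vanishes.
  have hout : ∀ z, z ∉ Γ.image → Γ.winding z = 0 →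
      h z = Γ.integral fun w => (w - z)⁻¹ • F w := by
    intro z hz hz0
    by_cases hzV : z ∈ V
    · have hne : ∀ w ∈ Γ.image, w ≠ z := fun w hw h => hz (h ▸ hw)
      have hinv : ContinuousOn (fun w : ℂ => (w - z)⁻¹) Γ.image :=
        ContinuousOn.inv₀ (by fun_prop) fun w hw => sub_ne_zero.2 (hne w hw)
      have h1 : Γ.integral (fun w => (w - z)⁻¹ • F z) = 0 := by
        have h2 := Γ.integral_clm_comp ((1 : ℂ →L[ℂ] ℂ).smulRight (F z)) hinv
        have h3 : Γ.integral (fun w => (w - z)⁻¹) = 0 := (mul_eq_zero.1 hz0).resolve_left h2pi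
        simpa [h3] using h2
      rw [← sub_zero (Γ.integral fun w => (w - z)⁻¹ • F w), ← h1,
        ← Γ.integral_sub (hinv.fun_smul hFc) (hinv.fun_smul continuousOn_const)]
      simp only [h, if_pos hzV]
      refine Γ.integral_congr fun w hw => ?_
      rw [dslope_of_ne F (hne w hw), slope_def_module, smul_sub]
    · simp only [h, if_neg hzV]
  have hdiff : Differentiable ℂ h := by
    intro z
    by_cases hzV : z ∈ V
    · have h1 := Γ.hasDerivAt_integral_param hV (Φ := dslope F)
        ((continuousOn_uncurry_dslope hV hF).mono (prod_mono_right hΓ)) (fun w hw => by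
          simp only [dslope_comm F _ w]
          exact (Complex.differentiableOn_dslope (hV.mem_nhds (hΓ hw))).2 hF) hzV
      refine h1.differentiableAt.congr_of_eventuallyEq ?_
      filter_upwards [hV.mem_nhds hzV] with y hy
      simp only [h, if_pos hy]
    · have hzΓ : z ∉ Γ.image := fun hmem => hzV (hΓ hmem)
      refine (Γ.hasDerivAt_cauchyTransform hFc hzΓ).differentiableAt.congr_of_eventuallyEq ?_
      filter_upwards [Γ.eventually_winding_eq hzΓ] with y hy
      exact hout y hy.1 (hy.2.trans (hw z hzV))
  have hlim : Tendsto h (cocompact ℂ) (𝓝 0) := by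
    refine (Γ.tendsto_cauchyTransform_cocompact hFc).congr' ?_
    filter_upwards [Γ.eventually_winding_eq_zero] with y hy
    exact (hout y hy.1 hy.2).symm
  have h0 := hdiff.apply_eq_of_tendsto_cocompact z hlim
  simpa only [h, if_pos hz] using h0

/-- **Cauchy's theorem** for a contour that does not wind around any point outside the domain. -/
theorem integral_eq_zero_of_winding [CompleteSpace G] (Γ : Contour) {V : Set ℂ} (hV : IsOpen V)
    {F : ℂ → G} (hF : DifferentiableOn ℂ F V) (hΓ : Γ.image ⊆ V)
    (hw : ∀ z, z ∉ V → Γ.winding z = 0) : Γ.integral F = 0 := by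
  rcases Γ.image.eq_empty_or_nonempty with he | ⟨z₀, hz₀⟩
  · rw [← Γ.integral_zero (G := G)]
    exact Γ.integral_congr (by simp [he])
  · -- `F` is the difference quotient at `z₀` of the function `(w - z₀) F(w)`.
    have hd : DifferentiableOn ℂ (fun w => (w - z₀) • F w) V := by fun_prop
    rw [← Γ.integral_dslope_eq_zero hV hd hΓ hw (hΓ hz₀)]
    refine Γ.integral_congr fun w hw => ?_
    rcases eq_or_ne w z₀ with rfl | hne
    · have h1 := ((hasDerivAt_id w).sub_const w).fun_smul
        (hF.differentiableAt (hV.mem_nhds (hΓ hw))).hasDerivAt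
      rw [dslope_same]
      simpa using h1.deriv.symm
    · rw [dslope_of_ne _ hne, slope_def_module, sub_self, zero_smul, sub_zero,
        inv_smul_smul₀ (sub_ne_zero.2 hne)]

theorem winding_contour_sub (Γ₁ Γ₂ : Contour) (z : ℂ) :
    (Γ₁.sub Γ₂).winding z = Γ₁.winding z - Γ₂.winding z := by
  simp only [winding, integral_contour_sub, mul_sub]

/-- Contours that wind equally around the points outside the domain of a holomorphic function give
the same integral. -/
theorem integral_eq_of_winding_eq [CompleteSpace G] (Γ₁ Γ₂ : Contour) {V : Set ℂ} (hV : IsOpen V)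
    {F : ℂ → G} (hF : DifferentiableOn ℂ F V) (h₁ : Γ₁.image ⊆ V) (h₂ : Γ₂.image ⊆ V)
    (hw : ∀ z, z ∉ V → Γ₁.winding z = Γ₂.winding z) : Γ₁.integral F = Γ₂.integral F := by
  rw [← sub_eq_zero, ← integral_contour_sub]
  refine integral_eq_zero_of_winding _ hV hF
    ((image_sub Γ₁ Γ₂).trans (union_subset h₁ h₂)) fun z hz => ?_
  rw [winding_contour_sub, hw z hz, sub_self]

theorem winding_circle {r : ℝ} {z : ℂ} (hz : ‖z‖ < r) : (circle r).winding z = 1 := by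
  rw [winding, integral_circle, circleIntegral.integral_sub_inv_of_mem_ball (by simpa using hz)]
  exact inv_mul_cancel₀ Complex.two_pi_I_ne_zero

/-- The residue at infinity: if `F` is holomorphic off a compact set `K` and `z F(z) → L` at
infinity, then the integral of `F` over a contour that winds once around `K` is `2πi L`. -/
theorem integral_eq_of_tendsto_cobounded [CompleteSpace G] (Γ : Contour) {K : Set ℂ}
    (hK : IsCompact K) (hΓ : Γ.image ⊆ Kᶜ) (hw : ∀ z ∈ K, Γ.winding z = 1) {F : ℂ → G}
    (hF : DifferentiableOn ℂ F Kᶜ) {L : G}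
    (hlim : Tendsto (fun z => z • F z) (Bornology.cobounded ℂ) (𝓝 L)) :
    Γ.integral F = (2 * (Real.pi : ℂ) * Complex.I) • L := by
  obtain ⟨R, hR0, hR⟩ := hK.isBounded.exists_pos_norm_le
  -- All large circles give the same integral.
  have hcirc : ∀ r > R, Γ.integral F = ∮ z in C(0, r), F z := fun r hr => by
    have hr0 : 0 < r := hR0.trans hr
    rw [← integral_circle]
    refine integral_eq_of_winding_eq Γ (circle r) hK.isClosed.isOpen_compl hF hΓ ?_ fun z hz => ?_
    · intro z hz hzK
      have h1 := image_circle_subset hr0.le hz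
      rw [mem_sphere_zero_iff_norm] at h1
      linarith [hR z hzK]
    · have hzK : z ∈ K := not_not.1 hz
      rw [hw z hzK, winding_circle ((hR z hzK).trans_lt hr)]
  rw [← sub_eq_zero, ← norm_eq_zero]
  refine le_antisymm (le_of_forall_pos_le_add fun ε hε => ?_) (norm_nonneg _)
  obtain ⟨r₀, hr₀⟩ : ∃ r₀ : ℝ, ∀ z : ℂ, r₀ < ‖z‖ → ‖z • F z - L‖ ≤ ε / (2 * Real.pi) := by
    have h1 := (Metric.tendsto_nhds.1 hlim) (ε / (2 * Real.pi)) (by positivity)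
    rw [atTop_basis_Ioi.cobounded_of_norm.eventually_iff] at h1
    obtain ⟨r₀, -, h⟩ := h1
    exact ⟨r₀, fun z hz => by rw [← dist_eq_norm]; exact (h hz).le⟩
  obtain ⟨r, hr⟩ := exists_gt (max R r₀)
  have hrR : R < r := (le_max_left _ _).trans_lt hr
  have hr0 : 0 < r := hR0.trans hrR
  have hL : ∮ z in C((0 : ℂ), r), (z - 0)⁻¹ • L = (2 * (Real.pi : ℂ) * Complex.I) • L := by
    rw [circleIntegral.integral_smul_const, circleIntegral.integral_sub_center_inv 0 hr0.ne']
  have hsph : ∀ z ∈ Metric.sphere (0 : ℂ) r, ‖z‖ = r := fun z hz => by simpa using hz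
  have hne : ∀ z ∈ Metric.sphere (0 : ℂ) r, z ≠ 0 := fun z hz h => by
    have := hsph z hz
    rw [h, norm_zero] at this
    exact hr0.ne this
  rw [hcirc r hrR, ← hL, ← circleIntegral.integral_sub, zero_add]
  · refine (circleIntegral.norm_integral_le_of_norm_le_const hr0.le
      (C := ε / (2 * Real.pi) / r) fun z hz => ?_).trans_eq (by field_simp)
    have h1 := hr₀ z (by rw [hsph z hz]; exact (le_max_right _ _).trans_lt hr)
    have h2 : F z - (z - 0)⁻¹ • L = z⁻¹ • (z • F z - L) := by
      rw [smul_sub, inv_smul_smul₀ (hne z hz), sub_zero]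
    rw [h2, norm_smul, norm_inv, hsph z hz, inv_mul_eq_div]
    gcongr
  · refine ContinuousOn.circleIntegrable hr0.le (hF.continuousOn.mono fun z hz hzK => ?_)
    linarith [hR z hzK, hsph z hz]
  · refine ContinuousOn.circleIntegrable hr0.le (ContinuousOn.smul (ContinuousOn.inv₀
      (by fun_prop) fun z hz => ?_) continuousOn_const)
    simpa using hne z hz

end Contour

/-! ### Divided differences as iterated difference quotients -/

/-- The iterated difference quotient `w ↦ f[v_0, …, v_{m-1}, w]`, in Newton's order: one node is
split off at a time. -/
noncomputable def iterDslope (f : ℂ → ℂ) : (m : ℕ) → (Fin m → ℂ) → ℂ → ℂ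
  | 0, _ => f
  | m + 1, v => iterDslope (dslope f (v 0)) m (Fin.tail v)

theorem dslope_congr {U : Set ℂ} (hU : IsOpen U) {f g : ℂ → ℂ} (h : EqOn f g U) {a : ℂ}
    (ha : a ∈ U) : EqOn (dslope f a) (dslope g a) U := by
  intro w hw
  rcases eq_or_ne w a with rfl | hne
  · rw [dslope_same, dslope_same]
    exact (h.eventuallyEq_of_mem (hU.mem_nhds ha)).deriv_eq
  · rw [dslope_of_ne f hne, dslope_of_ne g hne, slope_def_module, slope_def_module, h hw, h ha]

theorem iterDslope_congr {U : Set ℂ} (hU : IsOpen U) {f g : ℂ → ℂ} (h : EqOn f g U) {m : ℕ}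
    {v : Fin m → ℂ} (hv : ∀ k, v k ∈ U) : EqOn (iterDslope f m v) (iterDslope g m v) U := by
  induction m generalizing f g with
  | zero => exact h
  | succ m ih => exact ih (dslope_congr hU h (hv 0)) fun k => hv k.succ

/-- Second difference quotients are symmetric in their nodes: clear away from the nodes, and by
continuity at the nodes. -/
theorem dslope_dslope_comm {U : Set ℂ} (hU : IsOpen U) {f : ℂ → ℂ} (hf : DifferentiableOn ℂ f U)
    {a b : ℂ} (ha : a ∈ U) (hb : b ∈ U) :
    EqOn (dslope (dslope f a) b) (dslope (dslope f b) a) U := by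
  have hd : ∀ a ∈ U, ∀ b ∈ U, ContinuousOn (dslope (dslope f a) b) U := fun a ha b hb =>
    ((Complex.differentiableOn_dslope (hU.mem_nhds hb)).2
      ((Complex.differentiableOn_dslope (hU.mem_nhds ha)).2 hf)).continuousOn
  have hoff : ∀ w, w ≠ a → w ≠ b → dslope (dslope f a) b w = dslope (dslope f b) a w := by
    intro w hwa hwb
    have h1 := sub_smul_dslope f a b
    have hwa' := sub_ne_zero.2 hwa
    have hwb' := sub_ne_zero.2 hwb
    rw [dslope_of_ne _ hwb, dslope_of_ne _ hwa, slope_def_field, slope_def_field,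
      dslope_of_ne _ hwa, dslope_of_ne _ hwb, slope_def_field, slope_def_field,
      dslope_comm f b a]
    rw [smul_eq_mul] at h1
    field_simp
    linear_combination -h1
  intro w hw
  refine tendsto_nhds_unique_of_frequently_eq ((hd a ha b hb).continuousAt (hU.mem_nhds hw))
    ((hd b hb a ha).continuousAt (hU.mem_nhds hw)) ?_
  have hfin : ∀ᶠ y in 𝓝[≠] w, y ≠ a ∧ y ≠ b := by
    have h1 : ∀ c : ℂ, ∀ᶠ y in 𝓝[≠] w, y ≠ c := fun c => by
      rcases eq_or_ne w c with rfl | hne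
      · exact self_mem_nhdsWithin
      · exact nhdsWithin_le_nhds (isOpen_ne.mem_nhds hne)
    exact (h1 a).and (h1 b)
  exact (hfin.mono fun y hy => hoff y hy.1 hy.2).frequently.filter_mono nhdsWithin_le_nhds

theorem iterDslope_snoc (f : ℂ → ℂ) {m : ℕ} (v : Fin m → ℂ) (w : ℂ) :
    iterDslope f (m + 1) (Fin.snoc (α := fun _ => ℂ) v w) = dslope (iterDslope f m v) w := by
  induction m generalizing f with
  | zero => rfl
  | succ m ih =>
    rw [← Fin.cons_self_tail v, ← Fin.cons_snoc_eq_snoc_cons, iterDslope, Fin.tail_cons,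
      Fin.cons_zero, ih, iterDslope, Fin.tail_cons, Fin.cons_zero]

/-- The first node may be moved to the last place, by the symmetry of second difference
quotients. -/
theorem iterDslope_cons {U : Set ℂ} (hU : IsOpen U) {f : ℂ → ℂ} (hf : DifferentiableOn ℂ f U)
    {m : ℕ} {v : Fin m → ℂ} (hv : ∀ k, v k ∈ U) {w : ℂ} (hw : w ∈ U) :
    EqOn (iterDslope f (m + 1) (Fin.cons (α := fun _ => ℂ) w v))
      (dslope (iterDslope f m v) w) U := by
  induction m generalizing f with
  | zero => exact fun _ _ => rfl
  | succ m ih =>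
    intro z hz
    have hd := (Complex.differentiableOn_dslope (hU.mem_nhds (hv 0))).2 hf
    have hv' : ∀ k, Fin.tail v k ∈ U := fun k => hv k.succ
    have h1 := iterDslope_congr hU (dslope_dslope_comm hU hf hw (hv 0)) hv' hz
    exact h1.trans (ih hd hv' hz)

/-- Cyclic invariance: the free argument may be the last node or the first one. -/
theorem iterDslope_init_last {U : Set ℂ} (hU : IsOpen U) {f : ℂ → ℂ} (hf : DifferentiableOn ℂ f U)
    {m : ℕ} {v : Fin (m + 1) → ℂ} (hv : ∀ k, v k ∈ U) :
    iterDslope f m (Fin.init v) (v (Fin.last m)) = iterDslope f m (Fin.tail v) (v 0) := by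
  cases m with
  | zero => rfl
  | succ m =>
    have h1 := iterDslope_cons hU hf (v := Fin.tail (Fin.init v)) (fun k => hv _) (hv 0)
      (hv (Fin.last _))
    have h2 := congrFun (iterDslope_snoc f (Fin.init (Fin.tail v)) (v (Fin.last _))) (v 0)
    have e1 : Fin.cons (α := fun _ => ℂ) (v 0) (Fin.tail (Fin.init v)) = Fin.init v :=
      Fin.cons_self_tail (Fin.init v)
    have e2 : Fin.snoc (α := fun _ => ℂ) (Fin.init (Fin.tail v)) (v (Fin.last _)) = Fin.tail v :=
      Fin.snoc_init_self (Fin.tail v)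
    rw [e1] at h1
    rw [e2] at h2
    rw [h1, h2, dslope_comm, Fin.tail_init_eq_init_tail]

/-- On an open set where `f` is holomorphic, the recursive divided differences, confluent nodes
included, are the iterated difference quotients. -/
theorem dividedDiff_eq_iterDslope {U : Set ℂ} (hU : IsOpen U) {f : ℂ → ℂ}
    (hf : DifferentiableOn ℂ f U) {m : ℕ} {v : Fin (m + 1) → ℂ} (hv : ∀ k, v k ∈ U) :
    dividedDiff f m v = iterDslope f m (Fin.init v) (v (Fin.last m)) := by
  induction m with
  | zero => rfl
  | succ m ih =>
    -- With the inner nodes fixed, both sides are difference quotients of the same function `g`.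
    set g := iterDslope f m (Fin.tail (Fin.init v)) with hg
    have htail : dividedDiff f m (Fin.tail v) = g (v (Fin.last _)) := by
      rw [ih (v := Fin.tail v) fun k => hv _, hg, Fin.tail_init_eq_init_tail]
      rfl
    have hupd : ∀ x ∈ U, dividedDiff f m (Function.update (Fin.init v) 0 x) = g x := by
      intro x hx
      have hmem : ∀ k, Function.update (Fin.init v) 0 x k ∈ U := fun k => by
        rcases eq_or_ne k 0 with rfl | hk
        · rwa [Function.update_self]
        · rw [Function.update_of_ne hk]
          exact hv _
      rw [ih hmem, iterDslope_init_last hU hf hmem, Fin.tail_update_zero, Function.update_self]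
    have hinit : dividedDiff f m (Fin.init v) = g (v 0) := by
      have h1 := hupd (v 0) (hv 0)
      rwa [show v 0 = Fin.init v 0 from rfl, Function.update_eq_self] at h1
    have hright : iterDslope f (m + 1) (Fin.init v) (v (Fin.last _)) =
        dslope g (v 0) (v (Fin.last _)) := by
      have h1 := iterDslope_cons hU hf (v := Fin.tail (Fin.init v)) (fun k => hv _) (hv 0)
        (hv (Fin.last _))
      have e1 : Fin.cons (α := fun _ => ℂ) (v 0) (Fin.tail (Fin.init v)) = Fin.init v :=
        Fin.cons_self_tail (Fin.init v)
      rwa [e1] at h1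
    rw [hright, dividedDiff]
    split_ifs with h
    · rw [h, dslope_same]
      refine Filter.EventuallyEq.deriv_eq ?_
      filter_upwards [hU.mem_nhds (hv 0)] with x hx using hupd x hx
    · rw [htail, hinit, dslope_of_ne _ h, slope_def_field]

/-- With its first node `w` fixed, the divided difference of `f` is the divided difference, of one
order less, of the difference quotient `f[w, ·]`. -/
theorem dividedDiff_cons {U : Set ℂ} (hU : IsOpen U) {f : ℂ → ℂ} (hf : DifferentiableOn ℂ f U)
    {m : ℕ} {v : Fin (m + 1) → ℂ} (hv : ∀ k, v k ∈ U) {w : ℂ} (hw : w ∈ U) :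
    dividedDiff f (m + 1) (Fin.cons (α := fun _ => ℂ) w v) = dividedDiff (dslope f w) m v := by
  have hcons : ∀ k, Fin.cons (α := fun _ => ℂ) w v k ∈ U :=
    Fin.cases (by simpa using hw) fun k => by simpa using hv k
  rw [dividedDiff_eq_iterDslope hU hf hcons, dividedDiff_eq_iterDslope hU
    ((Complex.differentiableOn_dslope (hU.mem_nhds hw)).2 hf) hv, iterDslope,
    Fin.tail_init_eq_init_tail, Fin.tail_cons]
  rfl

/-! ### The holomorphic functional calculus -/

section Resolvent

variable {B : Type*} [NormedRing B] [NormedAlgebra ℂ B]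

theorem differentiableOn_resolvent [CompleteSpace B] (a : B) :
    DifferentiableOn ℂ (resolvent a) (spectrum ℂ a)ᶜ := fun _ hz =>
  (spectrum.hasDerivAt_resolvent_const_left (not_not.1 hz)).differentiableAt.differentiableWithinAt

theorem sub_mul_resolvent {a : B} {z : ℂ} (hz : z ∉ spectrum ℂ a) :
    (algebraMap ℂ B z - a) * resolvent a z = 1 :=
  Ring.mul_inverse_cancel _ (not_not.1 hz)

theorem resolvent_mul_sub {a : B} {z : ℂ} (hz : z ∉ spectrum ℂ a) :
    resolvent a z * (algebraMap ℂ B z - a) = 1 :=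
  Ring.inverse_mul_cancel _ (not_not.1 hz)

/-- The first resolvent identity. -/
theorem resolvent_sub_resolvent_eq {a : B} {z w : ℂ} (hz : z ∉ spectrum ℂ a)
    (hw : w ∉ spectrum ℂ a) :
    resolvent a w = resolvent a z + (z - w) • (resolvent a z * resolvent a w) := by
  have h1 : (z - w) • (1 : B) = (algebraMap ℂ B z - a) - (algebraMap ℂ B w - a) := by
    rw [sub_sub_sub_cancel_right, ← map_sub, Algebra.algebraMap_eq_smul_one]
  have h2 : (z - w) • (resolvent a z * resolvent a w) =
      resolvent a z * ((z - w) • (1 : B)) * resolvent a w := by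
    rw [mul_smul_comm, mul_one, smul_mul_assoc]
  rw [h2, h1, mul_sub, resolvent_mul_sub hz, sub_mul, one_mul, mul_assoc, sub_mul_resolvent hw,
    mul_one]
  abel

theorem tendsto_smul_resolvent [CompleteSpace B] (a : B) :
    Tendsto (fun z => z • resolvent a z) (Bornology.cobounded ℂ) (𝓝 1) := by
  have h1 : Tendsto (fun z => 1 + a * resolvent a z) (Bornology.cobounded ℂ) (𝓝 (1 + a * 0)) :=
    ((spectrum.resolvent_tendsto_cobounded a).const_mul a).const_add 1
  rw [mul_zero, add_zero] at h1
  refine h1.congr' ?_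
  filter_upwards [spectrum.eventually_isUnit_resolvent a] with z hz
  have h2 := sub_mul_resolvent (a := a) (z := z) (by
    rw [spectrum.notMem_iff]
    exact spectrum.isUnit_resolvent.2 hz)
  rw [sub_mul, ← Algebra.smul_def, sub_eq_iff_eq_add] at h2
  exact h2.symm

/-- A contour integral of the resolvent picks up the identity. -/
theorem integral_resolvent [CompleteSpace B] (a : B) {U : Set ℂ} {Γ : Contour}
    (hΓ : Γ.Surrounds (spectrum ℂ a) U) :
    Γ.integral (resolvent a) = (2 * (Real.pi : ℂ) * Complex.I) • 1 :=
  Γ.integral_eq_of_tendsto_cobounded (spectrum.isCompact a) (fun _ hz => (hΓ.image_subset hz).2)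
    hΓ.winding_eq_one (differentiableOn_resolvent a) (tendsto_smul_resolvent a)

/-- The functional calculus applied to the difference quotient `f[z, ·]`, for `z` off the
spectrum. -/
theorem integral_dslope_smul_resolvent [CompleteSpace B] (a : B) {U : Set ℂ} (hU : IsOpen U)
    {f : ℂ → ℂ} (hf : DifferentiableOn ℂ f U) {Γ : Contour}
    (hΓ : Γ.Surrounds (spectrum ℂ a) U) {z : ℂ}
    (hzU : z ∈ U) (hz : z ∉ spectrum ℂ a) :
    Γ.integral (fun w => dslope f w z • resolvent a w) =
      (2 * (Real.pi : ℂ) * Complex.I) • (f z • resolvent a z - resolvent a z * holoFun Γ f a) := by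
  have himU : Γ.image ⊆ U := fun w hw => (hΓ.image_subset hw).1
  have himR : Γ.image ⊆ (spectrum ℂ a)ᶜ := fun w hw => (hΓ.image_subset hw).2
  have hR : ContinuousOn (resolvent a) Γ.image := (differentiableOn_resolvent a).continuousOn.mono himR
  have hfc : ContinuousOn f Γ.image := hf.continuousOn.mono himU
  have hq : DifferentiableOn ℂ (dslope f z) U :=
    (Complex.differentiableOn_dslope (hU.mem_nhds hzU)).2 hf
  have hqc : ContinuousOn (dslope f z) Γ.image := hq.continuousOn.mono himU
  -- The resolvent identity reduces the integrand to holomorphic, constant and `f(a)` terms.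
  have h1 : EqOn (fun w => dslope f w z • resolvent a w)
      (fun w => (ContinuousLinearMap.toSpanSingleton ℂ (resolvent a z)) (dslope f z w) -
        (ContinuousLinearMap.mul ℂ B (resolvent a z))
          (f w • resolvent a w - f z • resolvent a w)) Γ.image := by
    intro w hw
    have h2 := sub_smul_dslope f z w
    have h3 : dslope f z w * (z - w) = f z - f w := by
      rw [smul_eq_mul] at h2
      linear_combination -h2
    simp only [ContinuousLinearMap.toSpanSingleton_apply, ContinuousLinearMap.mul_apply']
    rw [dslope_comm f w z, resolvent_sub_resolvent_eq hz (himR hw), smul_add, smul_smul, h3,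
      ← resolvent_sub_resolvent_eq hz (himR hw), ← sub_smul, mul_smul_comm, ← neg_sub (f w) (f z),
      neg_smul, ← sub_eq_add_neg]
  have hc : ContinuousOn (fun w => f w • resolvent a w - f z • resolvent a w) Γ.image :=
    (hfc.fun_smul hR).fun_sub (hR.const_smul _)
  rw [Γ.integral_congr h1, Γ.integral_sub
      (F₁ := fun w => ContinuousLinearMap.toSpanSingleton ℂ (resolvent a z) (dslope f z w))
      (F₂ := fun w => ContinuousLinearMap.mul ℂ B (resolvent a z)
        (f w • resolvent a w - f z • resolvent a w))
      ((ContinuousLinearMap.continuous _).comp_continuousOn hqc)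
      ((ContinuousLinearMap.continuous (ContinuousLinearMap.mul ℂ B (resolvent a z))).comp_continuousOn
        hc),
    Γ.integral_clm_comp _ hqc, Γ.integral_clm_comp _ hc,
    Γ.integral_sub (hfc.fun_smul hR) (hR.fun_const_smul _), Γ.integral_const_smul,
    integral_resolvent a hΓ,
    Γ.integral_eq_zero_of_winding hU hq himU hΓ.winding_eq_zero, map_zero, zero_sub]
  simp only [ContinuousLinearMap.mul_apply', holoFun]
  rw [mul_smul_comm, smul_sub, smul_smul _ _ (_ * _), mul_inv_cancel₀ Complex.two_pi_I_ne_zero,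
    one_smul, mul_sub, neg_sub, mul_smul_comm, mul_smul_comm, mul_one, smul_comm]

end Resolvent

/-! ### Iterated contour integrals -/

section Iterated

variable {G : Type*} [NormedAddCommGroup G] [NormedSpace ℂ G]

theorem iteratedIntegral_congr {m : ℕ} {Γ : Fin m → Contour} {F₁ F₂ : (Fin m → ℂ) → G}
    (h : ∀ v, (∀ k, v k ∈ (Γ k).image) → F₁ v = F₂ v) :
    iteratedIntegral m Γ F₁ = iteratedIntegral m Γ F₂ := by
  induction m with
  | zero => exact h _ fun k => k.elim0
  | succ m ih =>
    refine (Γ 0).integral_congr fun w hw => ih fun v hv => h _ ?_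
    exact Fin.cases (by simpa using hw) fun k => by simpa [Fin.tail] using hv k

end Iterated

/-! ### Change of contour and coupled integrals -/

theorem Contour.Surrounds.mono {Γ : Contour} {K K' U : Set ℂ} (h : Γ.Surrounds K U)
    (hK : K' ⊆ K) : Γ.Surrounds K' U where
  image_subset := h.image_subset.trans (sdiff_subset_sdiff_right hK)
  winding_eq_one w hw := h.winding_eq_one w (hK hw)
  winding_eq_zero := h.winding_eq_zero

theorem tendsto_clm_apply {ι H G : Type*} [NormedAddCommGroup H] [NormedSpace ℂ H]
    [NormedAddCommGroup G] [NormedSpace ℂ G] {l : Filter ι} {T : ι → H →L[ℂ] G} {x : ι → H}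
    {T₀ : H →L[ℂ] G} {x₀ : H} (hT : Tendsto T l (𝓝 T₀)) (hx : Tendsto x l (𝓝 x₀)) :
    Tendsto (fun i => T i (x i)) l (𝓝 (T₀ x₀)) :=
  (isBoundedBilinearMap_apply.continuous.tendsto (T₀, x₀)).comp (hT.prodMk_nhds hx)

section Calculus

variable {B : Type*} [NormedRing B] [NormedAlgebra ℂ B] [CompleteSpace B]

/-- The functional calculus does not depend on the contour. -/
theorem holoFun_eq_holoFun (a : B) {U : Set ℂ} (hU : IsOpen U) {f : ℂ → ℂ}
    (hf : DifferentiableOn ℂ f U) {Γ₁ Γ₂ : Contour} (h₁ : Γ₁.Surrounds (spectrum ℂ a) U)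
    (h₂ : Γ₂.Surrounds (spectrum ℂ a) U) : holoFun Γ₁ f a = holoFun Γ₂ f a := by
  have hd : DifferentiableOn ℂ (fun z => f z • resolvent a z) (U \ spectrum ℂ a) :=
    (hf.mono sdiff_subset).fun_smul ((differentiableOn_resolvent a).mono fun _ hz => hz.2)
  rw [holoFun, holoFun, Contour.integral_eq_of_winding_eq Γ₁ Γ₂
    (hU.sdiff (spectrum.isClosed a)) hd h₁.image_subset h₂.image_subset fun z hz => ?_]
  by_cases hzU : z ∈ U
  · have hza : z ∈ spectrum ℂ a := not_not.1 fun h => hz ⟨hzU, h⟩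
    rw [h₁.winding_eq_one z hza, h₂.winding_eq_one z hza]
  · rw [h₁.winding_eq_zero z hzU, h₂.winding_eq_zero z hzU]

variable {H : Type*} [NormedAddCommGroup H] [NormedSpace ℂ H] [CompleteSpace H]
  {G : Type*} [NormedAddCommGroup G] [NormedSpace ℂ G] [CompleteSpace G]

/-- Two contour integrals coupled by the difference quotient of `f` collapse into one.  The inner
integral over `Γ₀` produces `f(z) R(z) - R(z) f(a)`, and the term with `f(a)` integrates to zero
over `Γ` because its integrand is holomorphic off `K` and decays faster than `z⁻¹`. -/
theorem integral_integral_dslope (a : B) {U K : Set ℂ} (hU : IsOpen U) (hK : IsCompact K)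
    (haK : spectrum ℂ a ⊆ K) {f : ℂ → ℂ} (hf : DifferentiableOn ℂ f U) {Γ₀ Γ : Contour}
    (hΓ₀ : Γ₀.Surrounds (spectrum ℂ a) U) (hΓ : Γ.Surrounds K U) {P : ℂ → H}
    (hP : DifferentiableOn ℂ P Kᶜ) (hP0 : Tendsto P (Bornology.cobounded ℂ) (𝓝 0))
    (M : B →L[ℂ] H →L[ℂ] G) :
    Γ₀.integral (fun w => M (resolvent a w)
        ((2 * (Real.pi : ℂ) * Complex.I)⁻¹ • Γ.integral fun z => dslope f w z • P z)) =
      Γ.integral fun z => f z • M (resolvent a z) (P z) := by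
  have h₀U : Γ₀.image ⊆ U := fun w hw => (hΓ₀.image_subset hw).1
  have hΓU : Γ.image ⊆ U := fun w hw => (hΓ.image_subset hw).1
  have hΓK : Γ.image ⊆ Kᶜ := fun w hw => (hΓ.image_subset hw).2
  have hR₀ : ContinuousOn (resolvent a) Γ₀.image :=
    (differentiableOn_resolvent a).continuousOn.mono fun w hw => (hΓ₀.image_subset hw).2
  have hRK : DifferentiableOn ℂ (resolvent a) Kᶜ :=
    (differentiableOn_resolvent a).mono (compl_subset_compl.2 haK)
  have hPc : ContinuousOn P Γ.image := hP.continuousOn.mono hΓK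
  have hdc : ContinuousOn (Function.uncurry (dslope f)) (Γ₀.image ×ˢ Γ.image) :=
    (continuousOn_uncurry_dslope hU hf).mono (prod_mono h₀U hΓU)
  have hsec : ∀ w ∈ Γ₀.image, ContinuousOn (fun z => dslope f w z • P z) Γ.image :=
    fun w hw => (hdc.comp (f := fun z => (w, z)) (by fun_prop) fun z hz => ⟨hw, hz⟩).smul hPc
  have hsec' : ∀ z ∈ Γ.image, ContinuousOn (fun w => dslope f w z • resolvent a w) Γ₀.image :=
    fun z hz => (hdc.comp (f := fun w => (w, z)) (by fun_prop) fun w hw => ⟨hw, hz⟩).smul hR₀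
  have h1 : EqOn (fun w => M (resolvent a w)
        ((2 * (Real.pi : ℂ) * Complex.I)⁻¹ • Γ.integral fun z => dslope f w z • P z))
      (fun w => (2 * (Real.pi : ℂ) * Complex.I)⁻¹ •
        Γ.integral fun z => dslope f w z • M (resolvent a w) (P z)) Γ₀.image := by
    intro w hw
    simp only [map_smul]
    rw [← Γ.integral_clm_comp _ (hsec w hw)]
    simp only [map_smul]
  have hjoint : ContinuousOn (Function.uncurry fun w z => dslope f w z • M (resolvent a w) (P z))
      (Γ₀.image ×ˢ Γ.image) := by
    refine hdc.smul (ContinuousOn.clm_apply ?_ ?_)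
    · exact M.continuous.comp_continuousOn (hR₀.comp continuousOn_fst fun p hp => hp.1)
    · exact hPc.comp continuousOn_snd fun p hp => hp.2
  have h2 : EqOn (fun z => Γ₀.integral fun w => dslope f w z • M (resolvent a w) (P z))
      (fun z => (2 * (Real.pi : ℂ) * Complex.I) • (f z • M (resolvent a z) (P z) -
        M (resolvent a z * holoFun Γ₀ f a) (P z))) Γ.image := by
    intro z hz
    have h3 := Γ₀.integral_clm_comp (M.flip (P z)) (hsec' z hz)
    rw [integral_dslope_smul_resolvent a hU hf hΓ₀ (hΓU hz) fun h => hΓK hz (haK h)] at h3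
    simpa only [map_smul, map_sub, _root_.sub_apply, _root_.smul_apply,
      ContinuousLinearMap.flip_apply] using h3
  have hRc : ContinuousOn (resolvent a) Γ.image := hRK.continuousOn.mono hΓK
  have hdecay : Γ.integral (fun z => M (resolvent a z * holoFun Γ₀ f a) (P z)) = 0 := by
    have h4 := Γ.integral_eq_of_tendsto_cobounded hK hΓK hΓ.winding_eq_one
      (F := fun z => M (resolvent a z * holoFun Γ₀ f a) (P z)) (L := 0)
      (DifferentiableOn.clm_apply (M.differentiable.comp_differentiableOn (hRK.mul_const _)) hP) ?_
    · rw [h4, smul_zero]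
    · have h5 := tendsto_clm_apply ((M.continuous.tendsto _).comp
        ((tendsto_smul_resolvent a).mul_const (holoFun Γ₀ f a))) hP0
      rw [map_zero] at h5
      refine h5.congr fun z => ?_
      simp only [Function.comp_apply, smul_mul_assoc, map_smul, _root_.smul_apply]
  rw [Γ₀.integral_congr h1, Γ₀.integral_const_smul, Γ₀.integral_swap Γ hjoint,
    Γ.integral_congr h2, Γ.integral_const_smul, inv_smul_smul₀ Complex.two_pi_I_ne_zero,
    Γ.integral_sub, hdecay, sub_zero]
  · exact (hf.continuousOn.mono hΓU).smul ((M.continuous.comp_continuousOn hRc).clm_apply hPc)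
  · exact (M.continuous.comp_continuousOn (hRc.mul continuousOn_const)).clm_apply hPc

end Calculus

/-! ### Products along chains -/

section Chains

variable {n : ℕ} {E : Fin n → Type*} [∀ i, NormedAddCommGroup (E i)] [∀ i, NormedSpace ℂ (E i)]

/-- The union of the spectra of the diagonal blocks. -/
def diagSpectrum (A : (∀ i, E i) →L[ℂ] (∀ i, E i)) : Set ℂ := ⋃ i, spectrum ℂ (block A i i)

theorem spectrum_block_subset_diagSpectrum (A : (∀ i, E i) →L[ℂ] (∀ i, E i)) (i : Fin n) :
    spectrum ℂ (block A i i) ⊆ diagSpectrum A :=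
  subset_iUnion (fun i => spectrum ℂ (block A i i)) i

variable [∀ i, CompleteSpace (E i)]

theorem isCompact_diagSpectrum (A : (∀ i, E i) →L[ℂ] (∀ i, E i)) : IsCompact (diagSpectrum A) :=
  isCompact_iUnion fun i => spectrum.isCompact (block A i i)

theorem differentiableOn_chainProd (A : (∀ i, E i) →L[ℂ] (∀ i, E i)) {m : ℕ} {i j : Fin n}
    (c : Chain m i j) :
    DifferentiableOn ℂ (fun z => chainProd A c fun _ => z) (diagSpectrum A)ᶜ := by
  have hR : ∀ i, DifferentiableOn ℂ (resolvent (block A i i)) (diagSpectrum A)ᶜ := fun i =>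
    (differentiableOn_resolvent _).mono
      (compl_subset_compl.2 (spectrum_block_subset_diagSpectrum A i))
  induction c with
  | single i => exact hR i
  | cons i h c ih => exact (hR i).clm_comp ((differentiableOn_const _).clm_comp ih)

theorem tendsto_chainProd (A : (∀ i, E i) →L[ℂ] (∀ i, E i)) {m : ℕ} {i j : Fin n}
    (c : Chain m i j) :
    Tendsto (fun z => chainProd A c fun _ => z) (Bornology.cobounded ℂ) (𝓝 0) := by
  induction c with
  | single i => exact spectrum.resolvent_tendsto_cobounded _
  | @cons m i k j h c ih =>
    have h1 := tendsto_clm_apply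
      (((ContinuousLinearMap.compL ℂ (E j) (E i) (E i)).continuous.tendsto _).comp
        (spectrum.resolvent_tendsto_cobounded (block A i i)))
      (((ContinuousLinearMap.compL ℂ (E j) (E k) (E i) (block A i k)).continuous.tendsto _).comp ih)
    rw [map_zero, map_zero] at h1
    exact h1

/-- The iterated integral of a scalar divided difference along a chain collapses to a single
integral.  A continuous linear map `L` is carried along so that the factors already integrated
can be absorbed into it. -/
theorem iteratedIntegral_dividedDiff_chainProd {G : Type*} [NormedAddCommGroup G]
    [NormedSpace ℂ G] [CompleteSpace G] (A : (∀ i, E i) →L[ℂ] (∀ i, E i)) {U : Set ℂ}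
    (hU : IsOpen U) {Γ : Contour} (hΓ : Γ.Surrounds (diagSpectrum A) U) {m : ℕ} {i j : Fin n}
    (c : Chain m i j) {f : ℂ → ℂ} (hf : DifferentiableOn ℂ f U) (Γs : Fin (m + 1) → Contour)
    (hΓs : ∀ k, (Γs k).Surrounds (spectrum ℂ (block A (c.idx k) (c.idx k))) U)
    (L : (E j →L[ℂ] E i) →L[ℂ] G) :
    ((2 * (Real.pi : ℂ) * Complex.I)⁻¹ ^ (m + 1)) •
        iteratedIntegral (m + 1) Γs (fun z => dividedDiff f m z • L (chainProd A c z)) =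
      L (opDividedDiff Γ f A c) := by
  induction c generalizing f with
  | single i =>
    have h0 : (Γs 0).Surrounds (spectrum ℂ (block A i i)) U := hΓs 0
    have h1 := holoFun_eq_holoFun _ hU hf h0
      (hΓ.mono (spectrum_block_subset_diagSpectrum A i))
    have h2 : opDividedDiff Γ f A (.single i) = holoFun (Γs 0) f (block A i i) := h1.symm
    rw [h2, holoFun, map_smul, show (2 * (Real.pi : ℂ) * Complex.I)⁻¹ ^ (0 + 1) =
      (2 * (Real.pi : ℂ) * Complex.I)⁻¹ from pow_one _, ← (Γs 0).integral_clm_comp]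
    · simp only [map_smul]
      rfl
    · exact (hf.continuousOn.mono fun w hw => (h0.image_subset hw).1).smul
        ((differentiableOn_resolvent _).continuousOn.mono fun w hw => (h0.image_subset hw).2)
  | @cons m i k j h c ih =>
    have h0 : (Γs 0).Surrounds (spectrum ℂ (block A i i)) U := hΓs 0
    have hs : ∀ l, (Fin.tail Γs l).Surrounds (spectrum ℂ (block A (c.idx l) (c.idx l))) U :=
      fun l => hΓs l.succ
    -- `M R P = L (R ∘ A_{ik} ∘ P)`
    let M : (E i →L[ℂ] E i) →L[ℂ] (E j →L[ℂ] E k) →L[ℂ] G :=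
      ((ContinuousLinearMap.compL ℂ (E j →L[ℂ] E k) (E j →L[ℂ] E i) G).flip
        (ContinuousLinearMap.compL ℂ (E j) (E k) (E i) (block A i k))).comp
      ((ContinuousLinearMap.compL ℂ (E j →L[ℂ] E i) (E j →L[ℂ] E i) G L).comp
        (ContinuousLinearMap.compL ℂ (E j) (E i) (E i)))
    have hM : ∀ R P, M R P = L (R.comp ((block A i k).comp P)) := fun _ _ => rfl
    have hinner : EqOn (fun w => (2 * (Real.pi : ℂ) * Complex.I)⁻¹ ^ (m + 1) •
        iteratedIntegral (m + 1) (Fin.tail Γs) fun v =>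
          dividedDiff f (m + 1) (Fin.cons w v) • L (chainProd A (.cons i h c) (Fin.cons w v)))
        (fun w => M (resolvent (block A i i) w) ((2 * (Real.pi : ℂ) * Complex.I)⁻¹ •
          Γ.integral fun z => dslope f w z • chainProd A c fun _ => z)) (Γs 0).image := by
      intro w hw
      have hwU : w ∈ U := (h0.image_subset hw).1
      have h2 := ih (f := dslope f w) ((Complex.differentiableOn_dslope (hU.mem_nhds hwU)).2 hf)
        (Fin.tail Γs) hs (M (resolvent (block A i i) w))
      refine Eq.trans ?_ h2
      refine congrArg (_ • ·) (iteratedIntegral_congr fun v hv => ?_)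
      rw [dividedDiff_cons hU hf (fun l => ((hs l).image_subset (hv l)).1) hwU]
      rfl
    have hfinal := integral_integral_dslope (block A i i) hU (isCompact_diagSpectrum A)
      (spectrum_block_subset_diagSpectrum A i) hf h0 hΓ (differentiableOn_chainProd A c)
      (tendsto_chainProd A c) M
    rw [pow_succ', mul_smul, iteratedIntegral, ← Contour.integral_const_smul,
      Contour.integral_congr _ hinner, hfinal, opDividedDiff, map_smul, ← Γ.integral_clm_comp]
    · simp only [map_smul]
      rfl
    · exact (hf.continuousOn.mono fun w hw => (hΓ.image_subset hw).1).smul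
        ((differentiableOn_chainProd A (.cons i h c)).continuousOn.mono
          fun w hw => (hΓ.image_subset hw).2)

end Chains

/-! ### The resolvent of a lower triangular block matrix -/

section Triangular

variable {n : ℕ} {E : Fin n → Type*} [∀ i, NormedAddCommGroup (E i)] [∀ i, NormedSpace ℂ (E i)]

/-- Taking a block, as a continuous linear map on operators. -/
noncomputable def blockCLM (i j : Fin n) :
    ((∀ i, E i) →L[ℂ] (∀ i, E i)) →L[ℂ] (E j →L[ℂ] E i) :=
  (ContinuousLinearMap.compL ℂ (E j) (∀ i, E i) (E i) (ContinuousLinearMap.proj i)).comp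
    ((ContinuousLinearMap.compL ℂ (E j) (∀ i, E i) (∀ i, E i)).flip
      (ContinuousLinearMap.single ℂ E j))

theorem blockCLM_apply (i j : Fin n) (T : (∀ i, E i) →L[ℂ] (∀ i, E i)) :
    blockCLM i j T = block T i j := rfl

theorem block_one_self (i : Fin n) : block (1 : (∀ i, E i) →L[ℂ] (∀ i, E i)) i i = 1 := by
  ext x
  simp [block_apply]

theorem block_one_of_ne {i j : Fin n} (h : i ≠ j) :
    block (1 : (∀ i, E i) →L[ℂ] (∀ i, E i)) i j = 0 := by
  ext x
  simp [block_apply, Pi.single_eq_of_ne h]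

/-- On causal operators, taking a diagonal block is multiplicative. -/
noncomputable def diagBlock (i : Fin n) : causalAlgebra E →ₐ[ℂ] (E i →L[ℂ] E i) :=
  AlgHom.ofLinearMap ((blockCLM i i).toLinearMap ∘ₗ (causalAlgebra E).val.toLinearMap)
    (block_one_self i) fun S T => by
      change block (S.1 * T.1) i i = block S.1 i i * block T.1 i i
      rw [block_mul, Finset.sum_eq_single i]
      · rfl
      · intro k _ hk
        rcases lt_or_gt_of_ne hk with h | h
        · rw [T.2 k i h, ContinuousLinearMap.comp_zero]
        · rw [S.2 i k h, ContinuousLinearMap.zero_comp]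
      · simp

theorem diagSpectrum_subset_causalSpectrum (A : causalAlgebra E) :
    diagSpectrum (A : (∀ i, E i) →L[ℂ] (∀ i, E i)) ⊆ causalSpectrum A :=
  iUnion_subset fun i => AlgHom.spectrum_apply_subset (diagBlock i) A

theorem spectrum_subset_causalSpectrum (A : causalAlgebra E) :
    spectrum ℂ (A : (∀ i, E i) →L[ℂ] (∀ i, E i)) ⊆ causalSpectrum A :=
  AlgHom.spectrum_apply_subset (causalAlgebra E).val A

theorem resolvent_mem_causalAlgebra (A : causalAlgebra E) {z : ℂ} (hz : z ∉ causalSpectrum A) :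
    resolvent (A : (∀ i, E i) →L[ℂ] (∀ i, E i)) z ∈ causalAlgebra E := by
  have h1 : IsUnit (algebraMap ℂ (causalAlgebra E) z - A) := not_not.1 hz
  obtain ⟨u, hu⟩ := h1
  let u' : ((∀ i, E i) →L[ℂ] (∀ i, E i))ˣ := Units.map (causalAlgebra E).val.toMonoidHom u
  have h2 : algebraMap ℂ ((∀ i, E i) →L[ℂ] (∀ i, E i)) z - A.1 = u' :=
    (congrArg Subtype.val hu).symm
  rw [resolvent, h2, Ring.inverse_unit]
  exact ((u⁻¹ : (causalAlgebra E)ˣ) : causalAlgebra E).2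

/-- Forward substitution: each row of the resolvent is determined by the rows above it. -/
theorem block_resolvent_eq (A : causalAlgebra E) {z : ℂ} (hz : z ∉ causalSpectrum A)
    (i j : Fin n) :
    block (resolvent (A : (∀ i, E i) →L[ℂ] (∀ i, E i)) z) i j =
      (resolvent (block A.1 i i) z).comp (block 1 i j) +
        ∑ k : {k : Fin n // k < i}, (resolvent (block A.1 i i) z).comp
          ((block A.1 i k).comp (block (resolvent A.1 z) k j)) := by
  set R := resolvent A.1 z with hR
  have hz₁ : z ∉ spectrum ℂ A.1 := fun h => hz (spectrum_subset_causalSpectrum A h)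
  have hz₂ : z ∉ spectrum ℂ (block A.1 i i) := fun h =>
    hz (diagSpectrum_subset_causalSpectrum A (spectrum_block_subset_diagSpectrum _ i h))
  have h1 : z • R - A.1 * R = 1 := by
    rw [Algebra.smul_def, ← sub_mul]
    exact sub_mul_resolvent hz₁
  have h2 : z • block R i j - ∑ k, (block A.1 i k).comp (block R k j) = block 1 i j := by
    rw [← block_mul, ← h1]
    simp only [← blockCLM_apply, map_sub, map_smul]
  have h3 : ∑ k, (block A.1 i k).comp (block R k j) = (block A.1 i i).comp (block R i j) +
      ∑ k : {k : Fin n // k < i}, (block A.1 i k).comp (block R k j) := by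
    rw [← Finset.add_sum_erase _ _ (Finset.mem_univ i)]
    congr 1
    rw [← Finset.sum_subtype (Finset.univ.filter (· < i)) (by simp)
      fun k => (block A.1 i k).comp (block R k j)]
    refine (Finset.sum_subset (fun k hk => ?_) fun k hk hk' => ?_).symm
    · simpa using (Finset.mem_filter.1 hk).2.ne
    · have hlt : i < k := lt_of_le_of_ne (not_lt.1 fun h => hk' (by simpa using h))
        (Finset.ne_of_mem_erase hk).symm
      rw [A.2 i k hlt, ContinuousLinearMap.zero_comp]
  have h4 : (algebraMap ℂ (E i →L[ℂ] E i) z - block A.1 i i).comp (block R i j) =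
      block 1 i j + ∑ k : {k : Fin n // k < i}, (block A.1 i k).comp (block R k j) := by
    rw [← h2, h3, ContinuousLinearMap.sub_comp, Algebra.algebraMap_eq_smul_one,
      ContinuousLinearMap.smul_comp]
    have : (1 : E i →L[ℂ] E i).comp (block R i j) = block R i j := rfl
    rw [this]
    abel
  have h5 := congrArg (fun T => (resolvent (block A.1 i i) z).comp T) h4
  have h6 : (resolvent (block A.1 i i) z).comp
      (algebraMap ℂ (E i →L[ℂ] E i) z - block A.1 i i) = ContinuousLinearMap.id ℂ (E i) :=
    resolvent_mul_sub hz₂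
  simp only [← ContinuousLinearMap.comp_assoc] at h5
  rw [h6, ContinuousLinearMap.id_comp, ContinuousLinearMap.comp_add,
    ContinuousLinearMap.comp_finsetSum] at h5
  exact h5

/-- The blocks of the resolvent are the sums of the products along all chains. -/
theorem block_resolvent_eq_sum_chainProd (A : causalAlgebra E) {z : ℂ}
    (hz : z ∉ causalSpectrum A) {N : ℕ} {i : Fin n} (hi : (i : ℕ) < N) (j : Fin n) :
    block (resolvent (A : (∀ i, E i) →L[ℂ] (∀ i, E i)) z) i j =
      ∑ m ∈ Finset.range N, ∑ c : Chain m i j, chainProd A.1 c fun _ => z := by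
  -- The sum over chains with fewer than `N` steps satisfies the recursion of the resolvent.
  induction N generalizing i with
  | zero => exact absurd hi (Nat.not_lt_zero _)
  | succ N ih =>
    rw [Finset.sum_range_succ', block_resolvent_eq A hz, add_comm]
    congr 1
    · have h1 : ∀ m, ∑ c : Chain (m + 1) i j, chainProd A.1 c (fun _ => z) =
          ∑ k : {k : Fin n // k < i}, ∑ c : Chain m (k : Fin n) j,
            (resolvent (block A.1 i i) z).comp
              ((block A.1 i k).comp (chainProd A.1 c fun _ => z)) := fun m => by
        rw [← (Chain.succEquiv m i j).symm.sum_comp, Fintype.sum_sigma]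
        rfl
      simp only [h1]
      rw [Finset.sum_comm]
      refine Finset.sum_congr rfl fun k _ => ?_
      have hk : ((k : Fin n) : ℕ) < N := lt_of_lt_of_le k.2 (Nat.lt_succ_iff.1 hi)
      rw [ih hk]
      simp only [ContinuousLinearMap.comp_finsetSum]
    · rcases eq_or_ne i j with rfl | h
      · rw [Fintype.sum_eq_single (Chain.single i) fun c hc => absurd (by cases c; rfl) hc,
          block_one_self]
        rfl
      · have : IsEmpty (Chain 0 i j) := ⟨fun c => by cases c; exact h rfl⟩
        rw [Fintype.sum_empty, block_one_of_ne h, ContinuousLinearMap.comp_zero]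

end Triangular

/-! ### The blocks of `f(A)` -/

theorem block_holoFun {n : ℕ} {E : Fin n → Type*} [∀ i, NormedAddCommGroup (E i)]
    [∀ i, NormedSpace ℂ (E i)] [∀ i, CompleteSpace (E i)]
    (A : (∀ i, E i) →L[ℂ] (∀ i, E i)) {U : Set ℂ} {f : ℂ → ℂ} (hf : ContinuousOn f U)
    {Γ : Contour} (hΓ : Γ.Surrounds (spectrum ℂ A) U) (i j : Fin n) :
    block (holoFun Γ f A) i j = (2 * (Real.pi : ℂ) * Complex.I)⁻¹ •
      Γ.integral fun z => f z • block (resolvent A z) i j := by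
  have hc : ContinuousOn (fun z => f z • resolvent A z) Γ.image :=
    (hf.mono fun w hw => (hΓ.image_subset hw).1).smul
      ((differentiableOn_resolvent A).continuousOn.mono fun w hw => (hΓ.image_subset hw).2)
  rw [← blockCLM_apply, holoFun, map_smul, ← Γ.integral_clm_comp _ hc]
  simp only [map_smul, blockCLM_apply]

end CausalCalculus

open CausalCalculus in
theorem corollaryc {n : ℕ} {E : Fin n → Type*} [∀ i, NormedAddCommGroup (E i)]
    [∀ i, NormedSpace ℂ (E i)] [∀ i, CompleteSpace (E i)]
    (A : (∀ i, E i) →L[ℂ] (∀ i, E i)) (hA : A ∈ causalAlgebra E)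
    (U : Set ℂ) (hU : IsOpen U) (hAU : causalSpectrum ⟨A, hA⟩ ⊆ U)
    (f : ℂ → ℂ) (hf : AnalyticOnNhd ℂ f U)
    -- the contour that defines `f(A)`
    (Γ₀ : Contour) (hΓ₀ : Γ₀.Surrounds (spectrum ℂ A) U)
    -- the contour that defines the divided differences with operator arguments
    (Γ : Contour) (hΓ : Γ.Surrounds (causalSpectrum ⟨A, hA⟩) U) :
    -- `f(A)` is lower triangular
    (∀ i j : Fin n, i < j → block (holoFun Γ₀ f A) i j = 0) ∧
    -- its blocks are sums of divided differences along the decreasing chains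
    (∀ i j : Fin n, j ≤ i → block (holoFun Γ₀ f A) i j =
      ∑ m ∈ Finset.range n, ∑ c : Chain m i j, opDividedDiff Γ f A c) ∧
    -- the summands are the scalar divided differences with operators as arguments
    (∀ (m : ℕ) (i j : Fin n) (c : Chain m i j) (Γs : Fin (m + 1) → Contour),
      (∀ k, (Γs k).Surrounds (spectrum ℂ (block A (c.idx k) (c.idx k))) U) →
      opDividedDiff Γ f A c = ((2 * (Real.pi : ℂ) * Complex.I)⁻¹ ^ (m + 1)) •
        iteratedIntegral (m + 1) Γs fun z => dividedDiff f m z • chainProd A c z) := by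
  have hfd : DifferentiableOn ℂ f U := hf.differentiableOn
  have hΓA : Γ.Surrounds (spectrum ℂ A) U := hΓ.mono (spectrum_subset_causalSpectrum ⟨A, hA⟩)
  have hΓK : Γ.Surrounds (diagSpectrum A) U :=
    hΓ.mono (diagSpectrum_subset_causalSpectrum ⟨A, hA⟩)
  have hblock : ∀ i j, block (holoFun Γ₀ f A) i j = (2 * (Real.pi : ℂ) * Complex.I)⁻¹ •
      Γ.integral fun z => f z • block (resolvent A z) i j := fun i j => by
    rw [holoFun_eq_holoFun A hU hfd hΓ₀ hΓA, block_holoFun A hfd.continuousOn hΓA]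
  refine ⟨fun i j hij => ?_, fun i j _ => ?_, fun m i j c Γs hΓs => ?_⟩
  · have h0 : EqOn (fun z => f z • block (resolvent A z) i j) (fun _ => 0) Γ.image :=
      fun z hz => by
        simp only [resolvent_mem_causalAlgebra ⟨A, hA⟩ (hΓ.image_subset hz).2 i j hij, smul_zero]
    rw [hblock, Γ.integral_congr h0, Γ.integral_zero, smul_zero]
  · have hsum : EqOn (fun z => f z • block (resolvent A z) i j)
        (fun z => ∑ m ∈ Finset.range n, ∑ c : Chain m i j, f z • chainProd A c fun _ => z)
        Γ.image := fun z hz => by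
      simp only [block_resolvent_eq_sum_chainProd ⟨A, hA⟩ (hΓ.image_subset hz).2 i.2 j,
        Finset.smul_sum]
    have hc : ∀ {m : ℕ} (c : Chain m i j),
        ContinuousOn (fun z => f z • chainProd A c fun _ => z) Γ.image := fun c =>
      (hfd.continuousOn.mono fun w hw => (hΓ.image_subset hw).1).smul
        ((differentiableOn_chainProd A c).continuousOn.mono
          fun w hw => (hΓK.image_subset hw).2)
    rw [hblock, Γ.integral_congr hsum, Γ.integral_finsetSum _ fun m _ =>
      continuousOn_finsetSum _ fun c _ => hc c, Finset.smul_sum]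
    refine Finset.sum_congr rfl fun m _ => ?_
    rw [Γ.integral_finsetSum _ fun c _ => hc c, Finset.smul_sum]
    rfl
  · exact (iteratedIntegral_dividedDiff_chainProd A hU hΓK c hfd Γs hΓs
      (ContinuousLinearMap.id ℂ _)).symm
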